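/- For a locally integrable function \(f:\mathbb R\to\mathbb R\) let \[ \mathcal Mf(x)=\sup_{a<x<b}\frac1{b-a}\int_a^b f(y)\,dy \] be its uncentered Hardy--Littlewood maximal function, and let \[ \operatorname{var}(f)=\sup\Bigl\{-\int_{\mathbb R} f\varphi' : \varphi\in C^1_c(\mathbb R),\ |\varphi|\le 1\Bigr\}\in[0,\infty] \] be its variation. A locally integrable function \(f\) is called weakly differentiable if there is a locally integrable function \(f'\), its weak derivative, with \(\int f\varphi'=-\int f'\varphi\) for all \(\varphi\in C^1_c(\mathbb R)\). Theorem. There exists an absolute constant \(C>0\) such that for every weakly differentiable function \(f:\mathbb R\to\mathbb R\) which is even and nonincreasing on \((0,\infty)\), the maximal function \(\mathcal Mf\) is finite everywhere and weakly differentiable, and \[ \operatorname{var}\bigl((\mathcal Mf)'\bigr)\le C\operatorname{var}(f'). \] -/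

import Mathlib

open MeasureTheory
open scoped ENNReal

namespace UncenteredMaximal

/-- The set of all averages of `f` over the bounded open intervals `(a, b)` containing `x`. -/
def averages (f : ℝ → ℝ) (x : ℝ) : Set ℝ :=
  {A | ∃ a b : ℝ, a < x ∧ x < b ∧ A = (b - a)⁻¹ * ∫ y in a..b, f y}

/-- The uncentered Hardy-Littlewood maximal function on the line
(averages of `f` itself, not of its absolute value). -/
noncomputable def maximalFunction (f : ℝ → ℝ) (x : ℝ) : ℝ :=
  sSup (averages f x)

/-- `g` is a weak derivative of `f` on the line; both functions are locally integrable. -/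
structure HasWeakDeriv (f g : ℝ → ℝ) : Prop where
  locallyIntegrable : LocallyIntegrable f volume
  locallyIntegrable_deriv : LocallyIntegrable g volume
  integral_mul_deriv : ∀ φ : ℝ → ℝ, ContDiff ℝ 1 φ → HasCompactSupport φ →
    ∫ x, f x * deriv φ x = -∫ x, g x * φ x

/-- The variation on the line of a locally integrable function `g`: the supremum of
`-∫ g φ'` over all compactly supported `φ` of class `C¹` with `|φ| ≤ 1`. The supremum is
nonnegative because `φ = 0` is admissible, so nothing is lost by `ENNReal.ofReal`. -/
noncomputable def variation (g : ℝ → ℝ) : ℝ≥0∞ :=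
  ⨆ (φ : ℝ → ℝ) (_ : ContDiff ℝ 1 φ) (_ : HasCompactSupport φ) (_ : ∀ x, |φ x| ≤ 1),
    ENNReal.ofReal (-∫ x, g x * deriv φ x)

end UncenteredMaximal

open MeasureTheory
open scoped ENNReal
open Set Filter Topology

namespace UncenteredMaximal

/-! Write `V` for the variation of `f'`, that is, the total mass of the measure `f''`, and `M` for
the maximal function. The plan is to bound the negative part of `M''` on `(0, ∞)` and to deduce the
rest from a bound on `M'`.

For `x > 0` symmetry and monotonicity allow only intervals `(-t, x)` with `0 ≤ t ≤ x` to compete,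
and the supremum is attained at one of them (`Bell.exists_eq_avg`). Dilating this interval by `1 ±
ε` gives competitors at `(1 ± ε) x`, so `M ((1 + ε) x) + M ((1 - ε) x) - 2 M x` is at least the mean
of the same expression for `f` over `(-t, x)` (`Bell.dilDiff_maximalFunction_ge`). Divided by `ε²`,
it reads formally `x² M''(x) ≥ -(2 / x) ∫₀ˣ y² |f''(y)| dy`. Dividing by `x²` and integrating,
Fubini turns the right side into `-∫ |f''|`, since `∫_y^∞ 2 x⁻³ dx = y⁻²`. Hence the negative part
of `M''` on `(0, ∞)` has mass `O(V)`.

No second derivative is needed to make this rigorous: the dilation differences are kept at finite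
`ε` and estimated by duality (`VarBound.integral_abs_dilDiff_le`), the Fubini step is a Hardy type
inequality (`integral_primitive_div_cube_le`), and `ε → 0` is taken only on the test function
(`Bell.neg_le_integral_deriv_maximalFunction`).

Enlarging an optimal interval shows `|M'| ≤ V / 2` on `(0, ∞)`. The net mass of `M''` on an interval
is a difference of values of `M'`, so the positive part is bounded as well
(`neg_integral_mul_deriv_le`). Evenness of `M` handles the negative axis and the possible jump of
`M'` at `0`. -/

/-! ### Symmetric second differences in a dilation parameter. -/

/-- The symmetric second difference at `1` is controlled by the second derivative. -/
theorem abs_symm_diff_le {G G' G'' : ℝ → ℝ} {ε K : ℝ} (hε : 0 ≤ ε)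
    (h1 : ∀ l ∈ Icc (1 - ε) (1 + ε), HasDerivAt G (G' l) l)
    (h2 : ∀ l ∈ Icc (1 - ε) (1 + ε), HasDerivAt G' (G'' l) l)
    (h3 : ∀ l ∈ Icc (1 - ε) (1 + ε), |G'' l| ≤ K) :
    |G (1 + ε) + G (1 - ε) - 2 * G 1| ≤ 2 * K * ε ^ 2 := by
  have hK : 0 ≤ K := (abs_nonneg _).trans (h3 1 ⟨by linarith, by linarith⟩)
  have e1 : ∀ s ∈ Icc 0 ε, |G' (1 + s) - G' (1 - s)| ≤ 2 * K * ε := by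
    intro s hs
    have := (convex_Icc (1 - ε) (1 + ε)).norm_image_sub_le_of_norm_hasDerivWithin_le
      (f := G') (f' := G'') (C := K) (x := 1 - s) (y := 1 + s)
      (fun l hl => (h2 l hl).hasDerivWithinAt) (fun l hl => h3 l hl)
      ⟨by linarith [hs.2], by linarith [hs.1]⟩ ⟨by linarith [hs.1], by linarith [hs.2]⟩
    rw [Real.norm_eq_abs, Real.norm_eq_abs] at this
    refine this.trans ?_
    rw [show (1 + s - (1 - s)) = 2 * s by ring, abs_of_nonneg (by linarith [hs.1])]
    nlinarith [hs.2]
  have e2 := (convex_Icc 0 ε).norm_image_sub_le_of_norm_hasDerivWithin_le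
      (f := fun s => G (1 + s) + G (1 - s)) (f' := fun s => G' (1 + s) - G' (1 - s))
      (C := 2 * K * ε) (x := 0) (y := ε)
      (fun s hs => by
        have a1 := (h1 (1 + s) ⟨by linarith [hs.1], by linarith [hs.2]⟩).comp s
          ((hasDerivAt_id s).const_add 1)
        have a2 := (h1 (1 - s) ⟨by linarith [hs.2], by linarith [hs.1]⟩).comp s
          ((hasDerivAt_id s).const_sub 1)
        have := (a1.add a2).hasDerivWithinAt (s := Icc 0 ε)
        convert! this using 1
        ring)
      (fun s hs => e1 s hs) ⟨le_rfl, hε⟩ ⟨hε, le_rfl⟩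
  simp only [Real.norm_eq_abs, add_zero, sub_zero] at e2
  rw [abs_of_nonneg hε] at e2
  calc _ = |G (1 + ε) + G (1 - ε) - (G 1 + G 1)| := by ring_nf
    _ ≤ _ := e2
    _ = _ := by ring

/-- The symmetric second difference quotient converges to the second derivative. -/
theorem tendsto_symm_diff_div {G G' : ℝ → ℝ} {k : ℝ}
    (h1 : ∀ᶠ l in 𝓝 (1 : ℝ), HasDerivAt G (G' l) l) (h2 : HasDerivAt G' k 1) :
    Tendsto (fun ε : ℝ => (G (1 + ε) + G (1 - ε) - 2 * G 1) / ε ^ 2) (𝓝[>] 0) (𝓝 k) := by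
  have t1 : Tendsto (fun s : ℝ => 1 + s) (𝓝 0) (𝓝 1) := by
    have := (by fun_prop : Continuous fun s : ℝ => 1 + s).tendsto 0
    simpa only [add_zero] using this
  have t2 : Tendsto (fun s : ℝ => 1 - s) (𝓝 0) (𝓝 1) := by
    have := (by fun_prop : Continuous fun s : ℝ => 1 - s).tendsto 0
    simpa only [sub_zero] using this
  -- L'Hôpital is used only once, because `G'` is differentiable merely at `1`; what remains is half
  -- the sum of two difference quotients of `G'` there.
  refine HasDerivAt.lhopital_zero_nhdsGT (f' := fun s => G' (1 + s) - G' (1 - s))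
    (g' := fun s => 2 * s) ?_ ?_ ?_ ?_ ?_ ?_
  · filter_upwards [nhdsWithin_le_nhds (t1.eventually h1),
      nhdsWithin_le_nhds (t2.eventually h1)] with s hs1 hs2
    have := ((hs1.comp s ((hasDerivAt_id s).const_add 1)).add
      (hs2.comp s ((hasDerivAt_id s).const_sub 1))).sub_const (2 * G 1)
    convert! this using 1
    ring
  · exact Eventually.of_forall fun s => by simpa using hasDerivAt_pow 2 s
  · filter_upwards [self_mem_nhdsWithin] with s hs
    have : 0 < s := hs
    positivity
  · have hc : ContinuousAt G 1 := h1.self_of_nhds.continuousAt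
    have := ((hc.tendsto.comp t1).add (hc.tendsto.comp t2)).sub_const (2 * G 1)
    rw [show G 1 + G 1 - 2 * G 1 = 0 by ring] at this
    exact this.mono_left nhdsWithin_le_nhds
  · have : Tendsto (fun s : ℝ => s ^ 2) (𝓝 0) (𝓝 0) := by
      simpa using (continuous_pow 2 : Continuous fun s : ℝ => s ^ 2).tendsto 0
    exact this.mono_left nhdsWithin_le_nhds
  · have d1 : HasDerivAt (fun s => G' (1 + s)) k 0 := by
      have : HasDerivAt G' k (1 + id (0:ℝ)) := by simpa using h2
      exact (this.comp 0 ((hasDerivAt_id (0:ℝ)).const_add 1)).congr_deriv (by ring)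
    have d2 : HasDerivAt (fun s => G' (1 - s)) (-k) 0 := by
      have : HasDerivAt G' k (1 - id (0:ℝ)) := by simpa using h2
      exact (this.comp 0 ((hasDerivAt_id (0:ℝ)).const_sub 1)).congr_deriv (by ring)
    have d := (d1.sub d2).tendsto_slope_zero_right
    have := d.const_mul (1 / 2)
    rw [show 1 / 2 * (k - -k) = k by ring] at this
    refine this.congr fun s => ?_
    simp
    ring

/-! ### Dilation differences tested against a weak derivative. -/

/-- The symmetric second difference of `F` under the dilations by `1 + ε` and `1 - ε`. -/
def dilDiff (F : ℝ → ℝ) (ε y : ℝ) : ℝ := F ((1 + ε) * y) + F ((1 - ε) * y) - 2 * F y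

theorem continuous_dilDiff {F : ℝ → ℝ} (hF : Continuous F) (ε : ℝ) :
    Continuous (dilDiff F ε) := by
  unfold dilDiff; fun_prop

/-- The symmetric second difference of `T` under the inverse dilations. -/
noncomputable def invDilDiff (T : ℝ → ℝ) (ε x : ℝ) : ℝ :=
  T (x / (1 + ε)) + T (x / (1 - ε)) - 2 * T x

theorem integral_eq_zero_or_const {θ : ℝ → ℝ} {a b : ℝ} (ha : 0 < a)
    (hθ : Continuous θ) (h0 : ∀ x, x ∉ Icc a b → θ x = 0) :
    (∀ x ≤ a, ∫ y in (0:ℝ)..x, θ y = 0) ∧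
      ∀ x, b ≤ x → ∫ y in (0:ℝ)..x, θ y = ∫ y in (0:ℝ)..b, θ y := by
  constructor
  · intro x hx
    rw [intervalIntegral.integral_zero_ae]
    have : ∀ᵐ y : ℝ, y ≠ a := by simp [ae_iff, measure_singleton]
    filter_upwards [this] with y hy hxy
    apply h0
    intro h
    rcases le_total 0 x with hx0 | hx0
    · rw [uIoc_of_le hx0] at hxy
      exact hy (le_antisymm (hxy.2.trans hx) h.1)
    · rw [uIoc_of_ge hx0] at hxy
      linarith [hxy.2, h.1]
  · intro x hx
    rw [← intervalIntegral.integral_add_adjacent_intervals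
      (hθ.intervalIntegrable 0 b) (hθ.intervalIntegrable b x)]
    rw [add_eq_left, intervalIntegral.integral_zero_ae]
    refine Eventually.of_forall fun y hy => h0 y fun h => ?_
    rw [uIoc_of_le hx] at hy
    linarith [hy.1, h.2]

/-- A change of variables moves the dilations onto `θ`, and `θ (x / l) / l` is the derivative of `T
(x / l)` for the primitive `T` of `θ`. Although `T` need not vanish at infinity, `invDilDiff T ε`
has compact support: past the support of `θ` the constant value cancels in `1 + 1 - 2`. -/
theorem HasWeakDeriv.integral_dilDiff_mul {F q : ℝ → ℝ} (hF : HasWeakDeriv F q)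
    (hFc : Continuous F) {θ : ℝ → ℝ} {a b ε : ℝ} (ha : 0 < a) (hb : 0 < b)
    (hθ : Continuous θ) (h0 : ∀ x, x ∉ Icc a b → θ x = 0) (hε : 0 < ε) (hε1 : ε ≤ 1 / 2) :
    ∫ y, dilDiff F ε y * θ y =
      -∫ x, q x * invDilDiff (fun x => ∫ y in (0:ℝ)..x, θ y) ε x := by
  set T : ℝ → ℝ := fun x => ∫ y in (0:ℝ)..x, θ y with hT
  have hTd : ∀ x, HasDerivAt T (θ x) x := fun x => hθ.integral_hasStrictDerivAt 0 x |>.hasDerivAt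
  obtain ⟨z1, z2⟩ := integral_eq_zero_or_const ha hθ h0
  have hp : 0 < 1 + ε := by linarith
  have hm : 0 < 1 - ε := by linarith
  have hd : ∀ x, HasDerivAt (invDilDiff T ε)
      (θ (x / (1 + ε)) / (1 + ε) + θ (x / (1 - ε)) / (1 - ε) - 2 * θ x) x := by
    intro x
    have b1 := (hTd (x / (1 + ε))).comp x ((hasDerivAt_id x).div_const (1 + ε))
    have b2 := (hTd (x / (1 - ε))).comp x ((hasDerivAt_id x).div_const (1 - ε))
    have := (b1.add b2).sub ((hTd x).const_mul 2)
    convert! this using 1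
    ring
  have hderiv : deriv (invDilDiff T ε) =
      fun x => θ (x / (1 + ε)) / (1 + ε) + θ (x / (1 - ε)) / (1 - ε) - 2 * θ x :=
    funext fun x => (hd x).deriv
  have hC1 : ContDiff ℝ 1 (invDilDiff T ε) := by
    rw [contDiff_one_iff_deriv]
    refine ⟨fun x => (hd x).differentiableAt, ?_⟩
    rw [hderiv]; fun_prop
  have hcs : HasCompactSupport (invDilDiff T ε) := by
    refine HasCompactSupport.of_support_subset_isCompact (K := Icc 0 (b * (1 + ε)))
      isCompact_Icc ?_
    intro x hx
    by_contra hx'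
    refine hx ?_
    simp only [mem_Icc, not_and_or, not_le] at hx'
    unfold invDilDiff
    rcases hx' with h | h
    · have e1 : x / (1 + ε) ≤ a := (div_neg_of_neg_of_pos h hp).le.trans ha.le
      have e2 : x / (1 - ε) ≤ a := (div_neg_of_neg_of_pos h hm).le.trans ha.le
      simp only [hT, z1 _ e1, z1 _ e2, z1 x (by linarith)]; simp
    · have e1 : b ≤ x / (1 + ε) := by rw [le_div_iff₀ hp]; exact h.le
      have e0 : b ≤ x := by nlinarith
      have e2 : b ≤ x / (1 - ε) := by rw [le_div_iff₀ hm]; nlinarith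
      simp only [hT, z2 _ e1, z2 _ e2, z2 x e0]; ring
  rw [← hF.integral_mul_deriv _ hC1 hcs, hderiv]
  have hcsθ : HasCompactSupport θ :=
    HasCompactSupport.of_support_subset_isCompact (K := Icc a b) isCompact_Icc fun x hx => by
      by_contra hx'; exact hx (h0 x hx')
  have key : ∀ l : ℝ, 0 < l → (∫ y, F (l * y) * θ y = ∫ x, F x * (θ (x / l) / l)) ∧
      Integrable (fun y => F (l * y) * θ y) ∧ Integrable (fun x => F x * (θ (x / l) / l)) := by
    intro l hl
    have hi : Integrable (fun y => F (l * y) * θ y) :=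
      (Continuous.integrable_of_hasCompactSupport (by fun_prop) hcsθ.mul_left)
    have hi2 : Integrable (fun x => F x * θ (x / l)) := by
      have := hi.comp_div hl.ne'
      refine this.congr (Eventually.of_forall fun x => ?_)
      simp only
      rw [mul_div_cancel₀ _ hl.ne']
    refine ⟨?_, hi, ?_⟩
    · have := Measure.integral_comp_div (fun y => F (l * y) * θ y) l
      simp only [mul_div_cancel₀ _ hl.ne', abs_of_pos hl, smul_eq_mul] at this
      rw [← mul_right_inj' hl.ne', ← this, ← integral_const_mul]
      congr 1; ext x; field_simp
    · refine (hi2.div_const l).congr (Eventually.of_forall fun x => ?_)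
      simp only; ring
  obtain ⟨k1, i1, j1⟩ := key (1 + ε) hp
  obtain ⟨k2, i2, j2⟩ := key (1 - ε) hm
  have hi : Integrable (fun y => F y * θ y) :=
      (Continuous.integrable_of_hasCompactSupport (by fun_prop) hcsθ.mul_left)
  have L1 : ∫ y, dilDiff F ε y * θ y = (∫ y, F ((1 + ε) * y) * θ y) +
      (∫ y, F ((1 - ε) * y) * θ y) - ∫ y, 2 * (F y * θ y) := by
    rw [← integral_add i1 i2, ← integral_sub ?_ (hi.const_mul 2)]
    · congr 1; ext y; simp only [dilDiff]; ring
    · exact i1.add i2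
  have L2 : ∫ x, F x * (θ (x / (1 + ε)) / (1 + ε) + θ (x / (1 - ε)) / (1 - ε) - 2 * θ x) =
      (∫ x, F x * (θ (x / (1 + ε)) / (1 + ε))) +
      (∫ x, F x * (θ (x / (1 - ε)) / (1 - ε))) - ∫ y, 2 * (F y * θ y) := by
    rw [← integral_add j1 j2, ← integral_sub ?_ (hi.const_mul 2)]
    · congr 1; ext y; ring
    · exact j1.add j2
  rw [L1, L2, k1, k2]

/-- Real form of a bound on the variation. -/
def VarBound (q : ℝ → ℝ) (V : ℝ) : Prop :=
  ∀ φ : ℝ → ℝ, ContDiff ℝ 1 φ → HasCompactSupport φ → (∀ x, |φ x| ≤ 1) →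
    -∫ x, q x * deriv φ x ≤ V

theorem VarBound.nonneg {q : ℝ → ℝ} {V : ℝ} (h : VarBound q V) : 0 ≤ V := by
  have := h (fun _ => 0) contDiff_const HasCompactSupport.zero (by simp)
  simpa using this

theorem VarBound.scale {q : ℝ → ℝ} {V : ℝ} (h : VarBound q V) {φ : ℝ → ℝ} {B : ℝ}
    (hB : 0 < B) (h1 : ContDiff ℝ 1 φ) (h2 : HasCompactSupport φ) (h3 : ∀ x, |φ x| ≤ B) :
    -∫ x, q x * deriv φ x ≤ B * V := by
  have := h (fun x => B⁻¹ * φ x) (contDiff_const.mul h1) (h2.mul_left (f := fun _ => B⁻¹))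
    (fun x => by
      rw [abs_mul, abs_of_pos (inv_pos.2 hB), inv_mul_le_iff₀ hB]; simpa using h3 x)
  have e : (fun x => q x * deriv (fun x => B⁻¹ * φ x) x) =
      fun x => B⁻¹ * (q x * deriv φ x) := by
    ext x
    rw [deriv_const_mul _ (h1.differentiable one_ne_zero x)]; ring
  rw [e, integral_const_mul, ← mul_neg, inv_mul_le_iff₀ hB] at this
  exact this

/-- This is the dual form of "`dilDiff F ε` is about `ε² y² F''`": integrating once more exhibits
`invDilDiff T ε` as the derivative of a test function of size `4 ε²`. -/
theorem VarBound.integral_dilDiff_mul_le {F q : ℝ → ℝ} {V : ℝ} (hV : VarBound q V)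
    (hF : HasWeakDeriv F q)
    (hFc : Continuous F) {θ : ℝ → ℝ} {a b ε : ℝ} (ha : 0 < a) (hb : 0 < b)
    (hθ : Continuous θ) (h0 : ∀ x, x ∉ Icc a b → θ x = 0) (hε : 0 < ε) (hε1 : ε ≤ 1 / 2)
    (hb1 : ∀ x, |x ^ 2 * θ x| ≤ 1) :
    ∫ y, dilDiff F ε y * θ y ≤ 4 * ε ^ 2 * V := by
  rw [hF.integral_dilDiff_mul hFc ha hb hθ h0 hε hε1]
  set T : ℝ → ℝ := fun x => ∫ y in (0:ℝ)..x, θ y with hT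
  have hTd : ∀ x, HasDerivAt T (θ x) x := fun x => hθ.integral_hasStrictDerivAt 0 x |>.hasDerivAt
  have hTc : Continuous T := continuous_iff_continuousAt.2 fun x => (hTd x).continuousAt
  set U : ℝ → ℝ := fun x => ∫ y in (0:ℝ)..x, T y with hU
  have hUd : ∀ x, HasDerivAt U (T x) x := fun x => hTc.integral_hasStrictDerivAt 0 x |>.hasDerivAt
  obtain ⟨z1, z2⟩ := integral_eq_zero_or_const ha hθ h0
  have hp : 0 < 1 + ε := by linarith
  have hm : 0 < 1 - ε := by linarith
  have u1 : ∀ x ≤ 0, U x = 0 := by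
    intro x hx
    rw [hU]; simp only
    rw [intervalIntegral.integral_zero_ae]
    refine Eventually.of_forall fun y hy => z1 y ?_
    rw [uIoc_of_ge hx] at hy
    linarith [hy.2]
  have u2 : ∀ x, b ≤ x → U x = U b + (x - b) * T b := by
    intro x hx
    rw [hU]; simp only
    rw [← intervalIntegral.integral_add_adjacent_intervals
      (hTc.intervalIntegrable 0 b) (hTc.intervalIntegrable b x)]
    rw [add_right_inj, intervalIntegral.integral_congr (g := fun _ => T b)]
    · simp
    · intro y hy
      rw [uIcc_of_le hx] at hy
      exact z2 y hy.1
  -- For fixed `x` this is the symmetric second difference at `l = 1` of `l * U (x / l)`, whose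
  -- second derivative in `l` is `(x² / l³) θ (x / l)`; the weight `y² θ` thus appears by itself.
  let X : ℝ → ℝ := fun x =>
    (1 + ε) * U (x / (1 + ε)) + (1 - ε) * U (x / (1 - ε)) - 2 * U x
  have hXd : ∀ x, HasDerivAt X (invDilDiff T ε x) x := by
    intro x
    have b1 := ((hUd (x / (1 + ε))).comp x ((hasDerivAt_id x).div_const (1 + ε))).const_mul (1 + ε)
    have b2 := ((hUd (x / (1 - ε))).comp x ((hasDerivAt_id x).div_const (1 - ε))).const_mul (1 - ε)
    have := (b1.add b2).sub ((hUd x).const_mul 2)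
    convert! this using 1
    unfold invDilDiff
    field_simp
  have hXe : deriv X = invDilDiff T ε := funext fun x => (hXd x).deriv
  have hC1 : ContDiff ℝ 1 X := by
    rw [contDiff_one_iff_deriv]
    refine ⟨fun x => (hXd x).differentiableAt, ?_⟩
    rw [hXe]; unfold invDilDiff; fun_prop
  have hneg : ∀ x ≤ 0, X x = 0 := by
    intro x hx
    simp only [X, u1 _ (div_nonpos_of_nonpos_of_nonneg hx hp.le),
      u1 _ (div_nonpos_of_nonpos_of_nonneg hx hm.le), u1 x hx]
    simp
  have hcs : HasCompactSupport X := by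
    refine HasCompactSupport.of_support_subset_isCompact (K := Icc 0 (b * (1 + ε)))
      isCompact_Icc ?_
    intro x hx
    by_contra hx'
    refine hx ?_
    simp only [mem_Icc, not_and_or, not_le] at hx'
    rcases hx' with h | h
    · exact hneg x h.le
    · have e1 : b ≤ x / (1 + ε) := by rw [le_div_iff₀ hp]; exact h.le
      have e0 : b ≤ x := by nlinarith
      have e2 : b ≤ x / (1 - ε) := by rw [le_div_iff₀ hm]; nlinarith
      -- Past `b` the function `U` is affine, so `l * U (x / l)` is affine in `l` and its second
      -- difference vanishes.
      simp only [X, u2 _ e1, u2 _ e2, u2 x e0]; field_simp; ring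
  rw [← hXe]
  refine hV.scale (by positivity) hC1 hcs fun x => ?_
  rcases le_or_gt x 0 with hx | hx
  · rw [hneg x hx]; simp; positivity
  have := abs_symm_diff_le (G := fun l => l * U (x / l))
    (G' := fun l => U (x / l) - x / l * T (x / l))
    (G'' := fun l => (x ^ 2 / l ^ 3) * θ (x / l)) (ε := ε) (K := 2) hε.le
    (fun l hl => by
      have hl0 : 0 < l := by linarith [hl.1]
      have d : HasDerivAt (fun l => x / l) (-x / l ^ 2) l := by
        simpa [div_eq_mul_inv] using (hasDerivAt_inv hl0.ne').const_mul x
      have := (hasDerivAt_id l).mul ((hUd (x / l)).comp l d)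
      convert! this using 1
      simp
      field_simp
      ring)
    (fun l hl => by
      have hl0 : 0 < l := by linarith [hl.1]
      have d : HasDerivAt (fun l => x / l) (-x / l ^ 2) l := by
        simpa [div_eq_mul_inv] using (hasDerivAt_inv hl0.ne').const_mul x
      have := ((hUd (x / l)).comp l d).sub (d.mul ((hTd (x / l)).comp l d))
      convert! this using 1
      simp
      field_simp
      ring)
    (fun l hl => by
      have hl0 : 0 < l := by linarith [hl.1]
      have := hb1 (x / l)
      have e : x ^ 2 / l ^ 3 * θ (x / l) = l⁻¹ * ((x / l) ^ 2 * θ (x / l)) := by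
        field_simp
      rw [e, abs_mul, abs_of_pos (inv_pos.2 hl0)]
      -- Since `ε ≤ 1 / 2` forces `l ≥ 1 / 2`, the second derivative is at most `2`; this gives the
      -- `4` in `4 ε²`.
      have : l⁻¹ ≤ 2 := by
        rw [inv_le_comm₀ hl0 two_pos]; linarith [hl.1]
      nlinarith [abs_nonneg ((x / l) ^ 2 * θ (x / l)), inv_pos.2 hl0])
  have e : X x = (1 + ε) * U (x / (1 + ε)) + (1 - ε) * U (x / (1 - ε)) - 2 * (1 * U (x / 1)) := by
    simp [X]
  rw [e]
  linarith

/-- A continuous cutoff with values in `[0, 1]`, equal to `1` on `[a, b]`. -/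
theorem exists_continuous_cutoff {a b : ℝ} (ha : 0 < a) :
    ∃ χ : ℝ → ℝ, Continuous χ ∧ (∀ x, 0 ≤ χ x) ∧ (∀ x, χ x ≤ 1) ∧ (∀ x ∈ Icc a b, χ x = 1) ∧
      ∀ x, x ∉ Icc (a / 2) (b + a / 2) → χ x = 0 := by
  refine ⟨fun x => max 0 (min 1 (min (2 / a * (x - a / 2)) (2 / a * (b + a / 2 - x)))),
    by fun_prop, fun x => le_max_left _ _, fun x => max_le zero_le_one (min_le_left _ _), ?_, ?_⟩
  · intro x hx
    have h1 : 1 ≤ 2 / a * (x - a / 2) := by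
      rw [div_mul_eq_mul_div, le_div_iff₀ ha]; linarith [hx.1]
    have h2 : 1 ≤ 2 / a * (b + a / 2 - x) := by
      rw [div_mul_eq_mul_div, le_div_iff₀ ha]; linarith [hx.2]
    simp only [min_eq_left (le_min h1 h2)]
    simp
  · intro x hx
    simp only [mem_Icc, not_and_or, not_le] at hx
    have hpos : 0 < 2 / a := by positivity
    refine max_eq_left (min_le_of_right_le ?_)
    rcases hx with h | h
    · exact min_le_of_left_le (mul_nonpos_of_nonneg_of_nonpos hpos.le (by linarith))
    · exact min_le_of_right_le (mul_nonpos_of_nonneg_of_nonpos hpos.le (by linarith))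

/-- Duality: the preceding bound is applied with `θ` close to `sign (dilDiff F ε) / y²`. -/
theorem VarBound.integral_abs_dilDiff_le {F q : ℝ → ℝ} {V : ℝ} (hV : VarBound q V)
    (hF : HasWeakDeriv F q) (hFc : Continuous F) {a b ε : ℝ} (ha : 0 < a) (hab : a ≤ b)
    (hε : 0 < ε) (hε1 : ε ≤ 1 / 2) :
    ∫ y in a..b, |dilDiff F ε y| / y ^ 2 ≤ 4 * ε ^ 2 * V := by
  obtain ⟨χ, χc, χ0, χ1, χe, χs⟩ := exists_continuous_cutoff (b := b) ha
  have hh := continuous_dilDiff hFc ε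
  set h := dilDiff F ε with hhdef
  have ha2 : 0 < a / 2 := by positivity
  have hcont : ContinuousOn (fun y : ℝ => 1 / y ^ 2) (uIcc a b) := by
    intro y hy
    rw [uIcc_of_le hab] at hy
    have : y ≠ 0 := (ha.trans_le hy.1).ne'
    exact ContinuousAt.continuousWithinAt (by fun_prop (disch := positivity))
  have main : ∀ κ : ℝ, 0 < κ →
      ∫ y in a..b, |h y| / y ^ 2 ≤ 4 * ε ^ 2 * V + κ * ∫ y in a..b, 1 / y ^ 2 := by
    intro κ hκ
    -- A continuous sign of `h`: clamping `h / κ` to `[-1, 1]` costs at most `κ` in `|h|`, and `κ →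
    -- 0` at the end.
    let ψ : ℝ → ℝ := fun y => χ y * max (-1) (min 1 (h y / κ))
    -- The maximum keeps the denominator away from `0` and equals `y` wherever `ψ` is nonzero.
    let θ : ℝ → ℝ := fun y => ψ y / (max y (a / 2)) ^ 2
    have hm : ∀ y, 0 < max y (a / 2) := fun y => ha2.trans_le (le_max_right _ _)
    have hθc : Continuous θ := by
      refine Continuous.div (by fun_prop) (by fun_prop) fun y => ?_
      exact (pow_pos (hm y) 2).ne'
    have hc1 : ∀ t : ℝ, |max (-1) (min 1 t)| ≤ 1 := fun t =>
      abs_le.2 ⟨le_max_left _ _, max_le (by norm_num) (min_le_left _ _)⟩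
    have hψ1 : ∀ y, |ψ y| ≤ 1 := fun y => by
      simp only [ψ, abs_mul, abs_of_nonneg (χ0 y)]
      exact mul_le_one₀ (χ1 y) (abs_nonneg _) (hc1 _)
    have hψ0 : ∀ y, y ∉ Icc (a / 2) (b + a / 2) → ψ y = 0 := fun y hy => by
      simp [ψ, χs y hy]
    have hθ0 : ∀ y, y ∉ Icc (a / 2) (b + a / 2) → θ y = 0 := fun y hy => by
      simp [θ, hψ0 y hy]
    have hb1 : ∀ y, |y ^ 2 * θ y| ≤ 1 := by
      intro y
      by_cases hy : y ∈ Icc (a / 2) (b + a / 2)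
      · have : 0 < y := ha2.trans_le hy.1
        have e : y ^ 2 * θ y = ψ y := by
          simp only [θ, max_eq_left hy.1]; field_simp
        rw [e]; exact hψ1 y
      · simp [hθ0 y hy]
    have key := hV.integral_dilDiff_mul_le hF hFc ha2 (by linarith : 0 < b + a / 2) hθc hθ0 hε hε1
      hb1
    rw [← hhdef] at key
    have hcl : ∀ t : ℝ, |t| - κ ≤ t * max (-1) (min 1 (t / κ)) ∧
        0 ≤ t * max (-1) (min 1 (t / κ)) := by
      intro t
      rcases le_or_gt 0 t with ht | ht
      · have h1 : 0 ≤ t / κ := by positivity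
        rw [max_eq_right (le_trans (by norm_num) (le_min zero_le_one h1)), abs_of_nonneg ht]
        rcases le_total t κ with h2 | h2
        · have : 0 ≤ t * min 1 (t / κ) := mul_nonneg ht (le_min zero_le_one h1)
          exact ⟨by linarith, this⟩
        · rw [min_eq_left ((one_le_div hκ).2 h2)]
          constructor <;> linarith
      · have h1 : t / κ < 0 := div_neg_of_neg_of_pos ht hκ
        rw [min_eq_right (h1.le.trans zero_le_one), abs_of_neg ht]
        rcases le_total (-t) κ with h2 | h2
        · have : 0 ≤ t * max (-1) (t / κ) :=
            mul_nonneg_of_nonpos_of_nonpos ht.le (max_le (by norm_num) h1.le)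
          exact ⟨by linarith, this⟩
        · rw [max_eq_left (by rw [div_le_iff₀ hκ]; linarith)]
          constructor <;> linarith
    have hnn : ∀ y, 0 ≤ h y * θ y := by
      intro y
      have : h y * θ y = χ y * (h y * max (-1) (min 1 (h y / κ))) / (max y (a / 2)) ^ 2 := by
        simp only [θ, ψ]; ring
      rw [this]
      exact div_nonneg (mul_nonneg (χ0 y) (hcl _).2) (by positivity)
    have hint : Integrable (fun y => h y * θ y) := by
      refine Continuous.integrable_of_hasCompactSupport (by fun_prop) ?_
      exact HasCompactSupport.mul_left (HasCompactSupport.of_support_subset_isCompact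
        (K := Icc (a / 2) (b + a / 2)) isCompact_Icc fun x hx => by
          by_contra hx'; exact hx (hθ0 x hx'))
    have s1 : ∫ y in a..b, h y * θ y ≤ ∫ y, h y * θ y := by
      rw [intervalIntegral.integral_of_le hab]
      exact setIntegral_le_integral hint (Eventually.of_forall hnn)
    have s2 : ∫ y in a..b, |h y| / y ^ 2 ≤ ∫ y in a..b, (h y * θ y + κ * (1 / y ^ 2)) := by
      refine intervalIntegral.integral_mono_on hab ?_ ?_ ?_
      · refine ContinuousOn.intervalIntegrable ?_
        have := hh.abs.continuousOn.mul hcont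
        refine this.congr fun y _ => ?_
        simp [div_eq_mul_inv]
      · refine ContinuousOn.intervalIntegrable ?_
        exact (Continuous.continuousOn (by fun_prop)).add (hcont.const_mul κ)
      · intro y hy
        have hy0 : 0 < y := ha.trans_le hy.1
        have e : h y * θ y = (h y * max (-1) (min 1 (h y / κ))) / y ^ 2 := by
          have : max y (a / 2) = y := max_eq_left (by linarith [hy.1])
          simp only [θ, ψ, χe y hy, this]; ring
        rw [e, mul_one_div, ← add_div]
        gcongr
        linarith [(hcl (h y)).1]
    rw [intervalIntegral.integral_add (hint.intervalIntegrable)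
      ((hcont.const_mul κ).intervalIntegrable), intervalIntegral.integral_const_mul] at s2
    linarith
  have hJ : 0 ≤ ∫ y in a..b, 1 / y ^ 2 :=
    intervalIntegral.integral_nonneg hab fun y _ => by positivity
  set J := ∫ y in a..b, 1 / y ^ 2
  refine le_of_forall_pos_le_add fun δ hδ => ?_
  refine (main (δ / (J + 1)) (by positivity)).trans ?_
  gcongr
  rw [div_mul_eq_mul_div, div_le_iff₀ (by positivity)]
  nlinarith

/-! ### The Hardy type inequality. -/

/-- Hardy type inequality: integrating the mean of `h` against `2 / x ^ 3`. -/
theorem integral_primitive_div_cube_le {h : ℝ → ℝ} (hc : Continuous h) (h0 : ∀ x, 0 ≤ h x)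
    {B : ℝ} (hB : ∀ a b : ℝ, 0 < a → a ≤ b → ∫ y in a..b, h y / y ^ 2 ≤ B)
    {a b : ℝ} (ha : 0 < a) (hab : a ≤ b) :
    ∫ x in a..b, 2 * (∫ y in (0:ℝ)..x, h y) / x ^ 3 ≤ B := by
  set H : ℝ → ℝ := fun x => ∫ y in (0:ℝ)..x, h y with hH
  have hHd : ∀ x, HasDerivAt H (h x) x := fun x => hc.integral_hasStrictDerivAt 0 x |>.hasDerivAt
  have hHc : Continuous H := continuous_iff_continuousAt.2 fun x => (hHd x).continuousAt
  have cont : ∀ c d : ℝ, 0 < c → c ≤ d → ContinuousOn (fun y => h y / y ^ 2) (uIcc c d) := by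
    intro c d hc0 hcd y hy
    rw [uIcc_of_le hcd] at hy
    have : y ≠ 0 := (hc0.trans_le hy.1).ne'
    exact ContinuousAt.continuousWithinAt
      (hc.continuousAt.div (by fun_prop) (by positivity))
  have cont2 : ContinuousOn (fun y => 2 * H y / y ^ 3) (uIcc a b) := by
    intro y hy
    rw [uIcc_of_le hab] at hy
    have : y ≠ 0 := (ha.trans_le hy.1).ne'
    exact ContinuousAt.continuousWithinAt
      (ContinuousAt.div (by fun_prop) (by fun_prop) (by positivity))
  -- Integration by parts replaces Fubini, as `(-H / x²)' = 2 H / x³ - h / x²`.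
  have parts : ∫ x in a..b, (2 * H x / x ^ 3 - h x / x ^ 2) =
      -H b / b ^ 2 - -H a / a ^ 2 := by
    refine intervalIntegral.integral_eq_sub_of_hasDerivAt (f := fun x => -H x / x ^ 2) ?_ ?_
    · intro x hx
      rw [uIcc_of_le hab] at hx
      have hx0 : x ≠ 0 := (ha.trans_le hx.1).ne'
      have := (hHd x).neg.div (hasDerivAt_pow 2 x) (pow_ne_zero 2 hx0)
      convert! this using 1
      field_simp
      push_cast
      simp
      ring
    · exact (cont2.sub (cont a b ha hab)).intervalIntegrable
  rw [intervalIntegral.integral_sub cont2.intervalIntegrable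
    (cont a b ha hab).intervalIntegrable] at parts
  have hHb : 0 ≤ H b := intervalIntegral.integral_nonneg (ha.le.trans hab) fun y _ => h0 y
  have e1 : 0 ≤ H b / b ^ 2 := by positivity
  -- The boundary term at `a` is absorbed by the mass of `h / y²` on `(0, a)`, where `y⁻² ≥ a⁻²`.
  -- The left end `c > 0` is needed because `hB` only sees intervals away from `0`.
  have lim : H a / a ^ 2 + ∫ x in a..b, h x / x ^ 2 ≤ B := by
    have step : ∀ c ∈ Ioo 0 a, (H a - H c) / a ^ 2 + ∫ x in a..b, h x / x ^ 2 ≤ B := by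
      intro c hc'
      have e2 : H a - H c = ∫ y in c..a, h y :=
        intervalIntegral.integral_interval_sub_left (hc.intervalIntegrable _ _)
          (hc.intervalIntegrable _ _)
      have e3 : (∫ y in c..a, h y) / a ^ 2 ≤ ∫ y in c..a, h y / y ^ 2 := by
        rw [← intervalIntegral.integral_div]
        refine intervalIntegral.integral_mono_on hc'.2.le ?_ ?_ ?_
        · exact Continuous.intervalIntegrable (by fun_prop) _ _
        · exact (cont c a hc'.1 hc'.2.le).intervalIntegrable
        · intro y hy
          have : 0 < y := hc'.1.trans_le hy.1
          have := h0 y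
          gcongr
          exact hy.2
      have := hB c b hc'.1 (hc'.2.le.trans hab)
      rw [← intervalIntegral.integral_add_adjacent_intervals
        (cont c a hc'.1 hc'.2.le).intervalIntegrable (cont a b ha hab).intervalIntegrable] at this
      rw [e2]; linarith
    have t : Tendsto (fun c => (H a - H c) / a ^ 2 + ∫ x in a..b, h x / x ^ 2) (𝓝[>] 0)
        (𝓝 ((H a - H 0) / a ^ 2 + ∫ x in a..b, h x / x ^ 2)) := by
      refine Tendsto.mono_left ?_ nhdsWithin_le_nhds
      exact Continuous.tendsto (by fun_prop) _
    have h00 : H 0 = 0 := by simp [hH]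
    rw [h00, sub_zero] at t
    exact le_of_tendsto t (by
      filter_upwards [Ioo_mem_nhdsGT ha] with c hc'
      exact step c hc')
  have e4 : -H b / b ^ 2 - -H a / a ^ 2 = H a / a ^ 2 - H b / b ^ 2 := by ring
  rw [e4] at parts
  linarith

/-! ### Optimal intervals and regularity of the maximal function. -/

/-- Continuous even functions that are nonincreasing on `[0, ∞)`. -/
structure Bell (f : ℝ → ℝ) : Prop where
  cont : Continuous f
  even : Function.Even f
  anti : AntitoneOn f (Ici 0)

/-- The average of `f` over `(-t, x)`. -/
noncomputable def avg (f : ℝ → ℝ) (t x : ℝ) : ℝ := (x + t)⁻¹ * ∫ y in -t..x, f y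

theorem integral_le_mul {f : ℝ → ℝ} (hc : Continuous f) {c d m : ℝ} (hcd : c ≤ d)
    (h : ∀ y ∈ Icc c d, f y ≤ m) : ∫ y in c..d, f y ≤ m * (d - c) := by
  have := intervalIntegral.integral_mono_on (μ := volume) hcd (hc.intervalIntegrable c d)
    (continuous_const.intervalIntegrable c d) h
  simpa [mul_comm] using this

theorem mul_le_integral {f : ℝ → ℝ} (hc : Continuous f) {c d m : ℝ} (hcd : c ≤ d)
    (h : ∀ y ∈ Icc c d, m ≤ f y) : m * (d - c) ≤ ∫ y in c..d, f y := by
  have := intervalIntegral.integral_mono_on (μ := volume) hcd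
    (continuous_const.intervalIntegrable c d) (hc.intervalIntegrable c d) h
  simpa [mul_comm] using this

theorem integral_neg_eq_of_even {h : ℝ → ℝ} (hc : Continuous h) (he : Function.Even h) (x : ℝ) :
    ∫ y in -x..x, h y = 2 * ∫ y in (0:ℝ)..x, h y := by
  rw [← intervalIntegral.integral_add_adjacent_intervals (b := 0)
    (hc.intervalIntegrable _ _) (hc.intervalIntegrable _ _)]
  have : ∫ y in -x..0, h y = ∫ y in (0:ℝ)..x, h y := by
    have := intervalIntegral.integral_comp_neg (a := 0) (b := x) h
    simp only [he _, neg_zero] at this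
    exact this.symm
  rw [this]; ring

namespace Bell

variable {f : ℝ → ℝ}

theorem le_of_abs_le (hf : Bell f) {x y : ℝ} (h : |x| ≤ |y|) : f y ≤ f x := by
  have e : ∀ z, f |z| = f z := fun z => by
    rcases abs_cases z with ⟨h, _⟩ | ⟨h, _⟩ <;> rw [h]
    exact hf.even z
  rw [← e x, ← e y]
  exact hf.anti (abs_nonneg x) (abs_nonneg y) h

theorem averages_le (hf : Bell f) {x A : ℝ} (hA : A ∈ averages f x) : A ≤ f 0 := by
  obtain ⟨a, b, h1, h2, rfl⟩ := hA
  have hab : a < b := h1.trans h2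
  rw [inv_mul_le_iff₀ (sub_pos.2 hab), mul_comm]
  exact integral_le_mul hf.cont hab.le fun y _ => hf.le_of_abs_le (by simp)

theorem bddAbove_averages (hf : Bell f) (x : ℝ) : BddAbove (averages f x) :=
  ⟨f 0, fun _ hA => hf.averages_le hA⟩

theorem averages_nonempty (f : ℝ → ℝ) (x : ℝ) : (averages f x).Nonempty :=
  ⟨_, x - 1, x + 1, by linarith, by linarith, rfl⟩

theorem maximalFunction_le (hf : Bell f) (x : ℝ) : maximalFunction f x ≤ f 0 :=
  csSup_le (averages_nonempty f x) fun _ hA => hf.averages_le hA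

theorem even_maximalFunction (hf : Bell f) : Function.Even (maximalFunction f) := by
  intro x
  unfold maximalFunction
  congr 1
  have : ∀ x, averages f x ⊆ averages f (-x) := by
    rintro x A ⟨a, b, h1, h2, rfl⟩
    refine ⟨-b, -a, by linarith, by linarith, ?_⟩
    have := intervalIntegral.integral_comp_neg (a := a) (b := b) f
    simp only [hf.even _] at this
    rw [this]; congr 2; ring
  refine Subset.antisymm ?_ (this x)
  simpa using this (-x)

/-- Beyond `[-x, x]` the values are at most `f x`, inside they are at least `f x`, so discarding the
outer parts raises the mean. If the remaining interval `(c, x)` has `c > 0`, extending it leftwards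
to `0` adds larger values. -/
theorem exists_le_avg (hf : Bell f) {x A : ℝ} (hx : 0 < x) (hA : A ∈ averages f x) :
    ∃ t ∈ Icc 0 x, A ≤ avg f t x := by
  obtain ⟨a, b, h1, h2, rfl⟩ := hA
  have ii : ∀ c d, IntervalIntegrable f volume c d := fun c d => hf.cont.intervalIntegrable c d
  -- Removing a piece of mean at most `m` from one whose remainder has mean at least `m` does not
  -- lower the mean.
  have key : ∀ I R l r m : ℝ, 0 < l → 0 ≤ r → m * l ≤ I → R ≤ m * r →
      (l + r)⁻¹ * (I + R) ≤ l⁻¹ * I := by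
    intro I R l r m hl hr hI hR
    rw [inv_mul_le_iff₀ (by positivity), ← mul_assoc, ← div_eq_mul_inv, div_mul_eq_mul_div,
      le_div_iff₀ hl]
    nlinarith
  set c := max a (-x) with hc
  have hcx : c < x := max_lt h1 (by linarith)
  have hac : a ≤ c := le_max_left _ _
  have hxc : -x ≤ c := le_max_right _ _
  have s1 : (b - a)⁻¹ * ∫ y in a..b, f y ≤ (x - c)⁻¹ * ∫ y in c..x, f y := by
    have e : ∫ y in a..b, f y = (∫ y in c..x, f y) + ((∫ y in a..c, f y) + ∫ y in x..b, f y) := by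
      rw [← intervalIntegral.integral_add_adjacent_intervals (ii a c) (ii c b),
        ← intervalIntegral.integral_add_adjacent_intervals (ii c x) (ii x b)]
      ring
    have e2 : b - a = (x - c) + ((c - a) + (b - x)) := by ring
    rw [e, e2]
    refine key _ _ _ _ (f x) (by linarith) (by linarith) ?_ ?_
    · refine mul_le_integral hf.cont hcx.le fun y hy => hf.le_of_abs_le ?_
      rw [abs_of_pos hx]
      exact abs_le.2 ⟨by linarith [hy.1], hy.2⟩
    · rw [mul_add]
      refine add_le_add ?_ ?_
      · rcases le_total a (-x) with h | h
        · have hce : c = -x := max_eq_right h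
          refine integral_le_mul hf.cont hac fun y hy => hf.le_of_abs_le ?_
          rw [abs_of_pos hx]
          refine le_trans ?_ (neg_le_abs y)
          linarith [hy.2]
        · have hce : c = a := max_eq_left h
          rw [hce]; simp
      · refine integral_le_mul hf.cont h2.le fun y hy => hf.le_of_abs_le ?_
        rw [abs_of_pos hx]
        exact hy.1.trans (le_abs_self y)
  rcases le_or_gt c 0 with hc0 | hc0
  · refine ⟨-c, ⟨by linarith, by linarith⟩, s1.trans_eq ?_⟩
    simp [avg, sub_eq_add_neg]
  · refine ⟨0, ⟨le_rfl, hx.le⟩, s1.trans ?_⟩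
    have k1 : ∫ y in c..x, f y ≤ f c * (x - c) :=
      integral_le_mul hf.cont hcx.le fun y hy => hf.anti hc0.le (hc0.le.trans hy.1) hy.1
    have k2 : f c * (c - 0) ≤ ∫ y in (0:ℝ)..c, f y :=
      mul_le_integral hf.cont hc0.le fun y hy => hf.anti hy.1 hc0.le hy.2
    simp only [avg, add_zero, neg_zero]
    rw [← intervalIntegral.integral_add_adjacent_intervals (ii 0 c) (ii c x)]
    rw [inv_mul_le_iff₀ (by linarith), ← mul_assoc, ← div_eq_mul_inv, div_mul_eq_mul_div,
      le_div_iff₀ hx]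
    nlinarith

/-- The point `x` is an endpoint of `(-t, x)`, so this mean is not itself in `averages f x`; it is a
limit of means over `(-t, b)` as `b` decreases to `x`. -/
theorem avg_le_maximalFunction (hf : Bell f) {x t : ℝ} (hx : 0 < x) (ht : 0 ≤ t) :
    avg f t x ≤ maximalFunction f x := by
  have hPc : Continuous fun b => ∫ y in -t..b, f y :=
    continuous_iff_continuousAt.2 fun x =>
      (hf.cont.integral_hasStrictDerivAt (-t) x).hasDerivAt.continuousAt
  have t1 : Tendsto (fun b => (b + t)⁻¹ * ∫ y in -t..b, f y) (𝓝[>] x) (𝓝 (avg f t x)) := by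
    refine Tendsto.mono_left ?_ nhdsWithin_le_nhds
    have : x + t ≠ 0 := by positivity
    exact ContinuousAt.tendsto (ContinuousAt.mul (by fun_prop (disch := assumption))
      hPc.continuousAt)
  refine le_of_tendsto t1 ?_
  filter_upwards [self_mem_nhdsWithin] with b hb
  refine le_csSup (hf.bddAbove_averages x) ⟨-t, b, by linarith, hb, ?_⟩
  rw [sub_neg_eq_add]

theorem exists_eq_avg (hf : Bell f) {x : ℝ} (hx : 0 < x) :
    ∃ t ∈ Icc 0 x, maximalFunction f x = avg f t x := by
  have hc : ContinuousOn (fun t => avg f t x) (Icc 0 x) := by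
    have hPc : Continuous fun b => ∫ y in x..b, f y :=
      continuous_iff_continuousAt.2 fun z =>
        (hf.cont.integral_hasStrictDerivAt x z).hasDerivAt.continuousAt
    have e : (fun t => avg f t x) = fun t => (x + t)⁻¹ * -(∫ y in x..-t, f y) := by
      ext t; rw [avg, intervalIntegral.integral_symm]
    rw [e]
    intro t ht
    have : x + t ≠ 0 := by have := ht.1; positivity
    exact ContinuousAt.continuousWithinAt (ContinuousAt.mul (by fun_prop (disch := assumption))
      (hPc.comp continuous_neg).neg.continuousAt)
  obtain ⟨t, ht, hmax⟩ := isCompact_Icc.exists_isMaxOn ⟨0, le_rfl, hx.le⟩ hc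
  refine ⟨t, ht, le_antisymm (csSup_le (averages_nonempty f x) fun A hA => ?_)
    (hf.avg_le_maximalFunction hx ht.1)⟩
  obtain ⟨s, hs, hA⟩ := hf.exists_le_avg hx hA
  exact hA.trans (hmax hs)

theorem le_maximalFunction_of_pos (hf : Bell f) {x : ℝ} (hx : 0 < x) :
    f x ≤ maximalFunction f x := by
  refine le_trans ?_ (hf.avg_le_maximalFunction hx le_rfl)
  have := mul_le_integral hf.cont hx.le fun y hy => hf.anti hy.1 hx.le hy.2
  simp only [avg, add_zero, neg_zero]
  rw [le_inv_mul_iff₀ hx]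
  linarith

theorem maximalFunction_zero (hf : Bell f) : maximalFunction f 0 = f 0 := by
  refine le_antisymm (hf.maximalFunction_le 0) ?_
  have t1 : Tendsto f (𝓝[>] 0) (𝓝 (f 0)) := (hf.cont.tendsto 0).mono_left nhdsWithin_le_nhds
  refine le_of_tendsto t1 ?_
  filter_upwards [self_mem_nhdsWithin] with b hb
  have hb : 0 < b := hb
  have : (b - -b)⁻¹ * ∫ y in -b..b, f y ≤ maximalFunction f 0 :=
    le_csSup (hf.bddAbove_averages 0) ⟨-b, b, by linarith, hb, rfl⟩
  refine le_trans ?_ this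
  have := mul_le_integral hf.cont (by linarith : -b ≤ b) fun y hy =>
    hf.le_of_abs_le (x := y) (y := b) (by rw [abs_of_pos hb]; exact abs_le.2 ⟨hy.1, hy.2⟩)
  rw [le_inv_mul_iff₀ (by linarith)]
  linarith

theorem antitoneOn_maximalFunction (hf : Bell f) :
    AntitoneOn (maximalFunction f) (Ici 0) := by
  intro x hx y hy hxy
  rcases (show (0:ℝ) ≤ x from hx).eq_or_lt with rfl | hx0
  · rw [hf.maximalFunction_zero]; exact hf.maximalFunction_le y
  rcases hxy.eq_or_lt with rfl | hxy
  · exact le_rfl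
  obtain ⟨t, ht, e⟩ := hf.exists_eq_avg (hx0.trans hxy)
  rw [e]
  refine le_csSup (hf.bddAbove_averages x) ⟨-t, y, by linarith [ht.1], hxy, ?_⟩
  rw [avg, sub_neg_eq_add]

/-- The optimal interval `(-t, x)` at `x`, enlarged to `(-t, y)`, competes at `y`, and the added
piece has values at least `f y`. The factor `1 / y` comes from the length `y + t ≥ y`. -/
theorem maximalFunction_sub_le (hf : Bell f) {x y : ℝ} (hx : 0 < x) (hxy : x ≤ y) :
    maximalFunction f x - maximalFunction f y ≤ (y - x) * ((f 0 - f y) / y) := by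
  obtain ⟨t, ht, e⟩ := hf.exists_eq_avg hx
  have hy : 0 < y := hx.trans_le hxy
  have h1 := hf.avg_le_maximalFunction hy ht.1
  have hM := hf.maximalFunction_le x
  have hL : 0 < x + t := by linarith [ht.1]
  have hL2 : 0 < y + t := by linarith
  have eS : (x + t) * maximalFunction f x = ∫ z in -t..x, f z := by
    rw [e, avg]; field_simp
  have hR : f y * (y - x) ≤ ∫ z in x..y, f z :=
    mul_le_integral hf.cont hxy fun z hz => hf.anti (hx.le.trans hz.1) hy.le hz.2
  have h2 : ∫ z in -t..y, f z ≤ (y + t) * maximalFunction f y := by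
    rwa [avg, inv_mul_le_iff₀ hL2] at h1
  rw [← intervalIntegral.integral_add_adjacent_intervals (hf.cont.intervalIntegrable (-t) x)
    (hf.cont.intervalIntegrable x y), ← eS] at h2
  have hfy : f y ≤ f 0 := hf.le_of_abs_le (by simp)
  have h3 : (y + t) * (maximalFunction f x - maximalFunction f y) ≤ (y - x) * (f 0 - f y) := by
    nlinarith
  rw [← mul_div_assoc, le_div_iff₀ hy]
  have hanti := hf.antitoneOn_maximalFunction hx.le hy.le hxy
  nlinarith [ht.1, mul_nonneg ht.1 (sub_nonneg.2 hanti)]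

theorem lipschitzOnWith_maximalFunction (hf : Bell f) {a b : ℝ} (ha : 0 < a) :
    LipschitzOnWith (Real.toNNReal ((f 0 - f b) / a)) (maximalFunction f) (Icc a b) := by
  rcases le_or_gt a b with hab | hab
  swap
  · rw [Icc_eq_empty (not_le.2 hab)]; exact lipschitzOnWith_empty _ _
  have hfb : f b ≤ f 0 := hf.le_of_abs_le (by simp)
  have main : ∀ x ∈ Icc a b, ∀ y ∈ Icc a b, x ≤ y →
      |maximalFunction f x - maximalFunction f y| ≤ (f 0 - f b) / a * |x - y| := by
    intro x hx y hy hxy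
    have hx0 := ha.trans_le hx.1
    have hy0 := ha.trans_le hy.1
    rw [abs_of_nonneg (sub_nonneg.2 (hf.antitoneOn_maximalFunction hx0.le hy0.le hxy)),
      abs_sub_comm, abs_of_nonneg (sub_nonneg.2 hxy), mul_comm]
    refine (hf.maximalFunction_sub_le hx0 hxy).trans ?_
    have h1 : f b ≤ f y := hf.anti hy0.le (hy0.le.trans hy.2) hy.2
    refine mul_le_mul_of_nonneg_left ?_ (sub_nonneg.2 hxy)
    exact div_le_div₀ (by linarith) (by linarith) ha hy.1
  refine LipschitzOnWith.of_dist_le_mul fun x hx y hy => ?_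
  rw [Real.dist_eq, Real.dist_eq, Real.coe_toNNReal _ (div_nonneg (by linarith) ha.le)]
  rcases le_total x y with h | h
  · exact main x hx y hy h
  · rw [abs_sub_comm, abs_sub_comm x y]; exact main y hy x hx h

theorem continuous_maximalFunction (hf : Bell f) : Continuous (maximalFunction f) := by
  have hon : ContinuousOn (maximalFunction f) (Ici 0) := by
    intro x hx
    rcases (show (0:ℝ) ≤ x from hx).eq_or_lt with rfl | hx0
    · have t1 : Tendsto f (𝓝[≥] 0) (𝓝 (f 0)) := (hf.cont.tendsto 0).mono_left nhdsWithin_le_nhds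
      unfold ContinuousWithinAt
      rw [hf.maximalFunction_zero]
      refine tendsto_of_tendsto_of_tendsto_of_le_of_le' t1 tendsto_const_nhds ?_
        (Eventually.of_forall hf.maximalFunction_le)
      filter_upwards [self_mem_nhdsWithin] with z hz
      rcases (show (0:ℝ) ≤ z from hz).eq_or_lt with rfl | hz0
      · exact hf.maximalFunction_zero.ge
      · exact hf.le_maximalFunction_of_pos hz0
    · exact ((hf.lipschitzOnWith_maximalFunction (a := x / 2) (b := 2 * x)
        (by positivity)).continuousOn.continuousAt
        (Icc_mem_nhds (by linarith) (by linarith))).continuousWithinAt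
  have e : maximalFunction f = fun x => maximalFunction f |x| := by
    ext x
    rcases abs_cases x with ⟨h, _⟩ | ⟨h, _⟩ <;> rw [h]
    exact (hf.even_maximalFunction x).symm
  rw [e]
  exact hon.comp_continuous continuous_abs abs_nonneg

/-! ### Dilating the optimal interval. -/

/-- Dilating the optimal interval bounds the dilation second difference of the maximal function
from below by the corresponding average for `f`. -/
theorem dilDiff_maximalFunction_ge (hf : Bell f) {x ε : ℝ} (hx : 0 < x) (hε : 0 < ε)
    (hε1 : ε ≤ 1 / 2) :
    -(2 * ∫ y in (0:ℝ)..x, |dilDiff f ε y|) / x ≤ dilDiff (maximalFunction f) ε x := by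
  obtain ⟨t, ht, e⟩ := hf.exists_eq_avg hx
  have hL : 0 < x + t := by linarith [ht.1]
  have hdil : ∀ l : ℝ, 0 < l →
      (x + t)⁻¹ * ∫ y in -t..x, f (l * y) ≤ maximalFunction f (l * x) := by
    intro l hl
    refine le_trans (le_of_eq ?_)
      (hf.avg_le_maximalFunction (mul_pos hl hx) (mul_nonneg hl.le ht.1))
    rw [avg, intervalIntegral.integral_comp_mul_left _ hl.ne', ← mul_add, mul_inv, smul_eq_mul]
    rw [mul_neg]; ring
  have hd := continuous_dilDiff hf.cont ε
  have k1 : (x + t)⁻¹ * ∫ y in -t..x, dilDiff f ε y ≤ dilDiff (maximalFunction f) ε x := by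
    have h1 := hdil (1 + ε) (by linarith)
    have h2 := hdil (1 - ε) (by linarith)
    have hc := hf.cont
    have i1 : IntervalIntegrable (fun y => f ((1 + ε) * y)) volume (-t) x :=
      Continuous.intervalIntegrable (by fun_prop) _ _
    have i2 : IntervalIntegrable (fun y => f ((1 - ε) * y)) volume (-t) x :=
      Continuous.intervalIntegrable (by fun_prop) _ _
    have i3 : IntervalIntegrable (fun y => 2 * f y) volume (-t) x :=
      Continuous.intervalIntegrable (by fun_prop) _ _
    have eq : ∫ y in -t..x, dilDiff f ε y = (∫ y in -t..x, f ((1 + ε) * y)) +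
        (∫ y in -t..x, f ((1 - ε) * y)) - 2 * ∫ y in -t..x, f y := by
      rw [← intervalIntegral.integral_const_mul, ← intervalIntegral.integral_add i1 i2,
        ← intervalIntegral.integral_sub (i1.add i2) i3]
      rfl
    rw [eq, dilDiff, e, avg]
    linarith
  -- Passing to absolute values allows the unknown `t` to be replaced by `x`.
  have k2 : -(∫ y in -x..x, |dilDiff f ε y|) ≤ ∫ y in -t..x, dilDiff f ε y := by
    have a1 : -(∫ y in -t..x, |dilDiff f ε y|) ≤ ∫ y in -t..x, dilDiff f ε y :=
      (abs_le.1 (intervalIntegral.abs_integral_le_integral_abs (by linarith))).1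
    have a2 : ∫ y in -t..x, |dilDiff f ε y| ≤ ∫ y in -x..x, |dilDiff f ε y| :=
      intervalIntegral.integral_mono_interval (by linarith [ht.2]) (by linarith) le_rfl
        (Eventually.of_forall fun _ => abs_nonneg _) (hd.abs.intervalIntegrable _ _)
    linarith
  have heven : Function.Even fun y => |dilDiff f ε y| := by
    intro y
    simp only [dilDiff, mul_neg, hf.even _]
  rw [integral_neg_eq_of_even hd.abs heven] at k2
  refine le_trans ?_ k1
  have hN : 0 ≤ 2 * ∫ y in (0:ℝ)..x, |dilDiff f ε y| :=
    mul_nonneg two_pos.le (intervalIntegral.integral_nonneg hx.le fun _ _ => abs_nonneg _)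
  calc -(2 * ∫ y in (0:ℝ)..x, |dilDiff f ε y|) / x
      ≤ -(2 * ∫ y in (0:ℝ)..x, |dilDiff f ε y|) / (x + t) := by
        rw [neg_div, neg_div, neg_le_neg_iff]
        exact div_le_div_of_nonneg_left hN hx (by linarith [ht.1])
    _ = (x + t)⁻¹ * -(2 * ∫ y in (0:ℝ)..x, |dilDiff f ε y|) := by rw [div_eq_inv_mul]
    _ ≤ _ := mul_le_mul_of_nonneg_left k2 (inv_pos.2 hL).le

end Bell

/-! ### Weak derivatives and continuous representatives. -/

theorem exists_eq_zero_of_hasCompactSupport {φ : ℝ → ℝ} (h : HasCompactSupport φ) :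
    ∃ R : ℝ, 0 < R ∧ ∀ x, R ≤ |x| → φ x = 0 := by
  obtain ⟨R, hR⟩ := h.isCompact.isBounded.subset_closedBall 0
  refine ⟨max R 0 + 1, by positivity, fun x hx => ?_⟩
  by_contra hne
  have := hR (subset_tsupport φ hne)
  rw [mem_closedBall_zero_iff, Real.norm_eq_abs] at this
  linarith [le_max_left R 0]

theorem integral_eq_intervalIntegral {h : ℝ → ℝ} {a b : ℝ} (h0 : ∀ x, x ∉ Ioo a b → h x = 0) :
    ∫ x, h x = ∫ x in a..b, h x := by
  refine (intervalIntegral.integral_eq_integral_of_support_subset fun x hx => ?_).symm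
  by_contra hx'
  exact hx (h0 x fun hm => hx' (Ioo_subset_Ioc_self hm))

/-- A primitive of a locally integrable function has that function as its weak derivative. -/
theorem hasWeakDeriv_of_integral {F g : ℝ → ℝ} (hg : LocallyIntegrable g)
    (h : ∀ x, F x = F 0 + ∫ y in (0:ℝ)..x, g y) : HasWeakDeriv F g := by
  have hii : ∀ a b, IntervalIntegrable g volume a b := fun a b =>
    (hg.integrableOn_isCompact isCompact_uIcc).intervalIntegrable
  have hFc : Continuous F := by
    rw [funext h]
    exact continuous_const.add (intervalIntegral.continuous_primitive hii 0)
  refine ⟨hFc.locallyIntegrable, hg, fun φ h1 h2 => ?_⟩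
  obtain ⟨R, hR0, hR⟩ := exists_eq_zero_of_hasCompactSupport h2
  obtain ⟨R', hR0', hR'⟩ := exists_eq_zero_of_hasCompactSupport h2.deriv
  set r := max R R' with hr
  have hr0 : 0 < r := lt_max_of_lt_left hR0
  have hout : ∀ x, x ∉ Ioo (-r) r → r ≤ |x| := fun x hx => by
    by_contra hlt
    exact hx (abs_lt.1 (not_le.1 hlt))
  have z1 : ∀ x, r ≤ |x| → φ x = 0 := fun x hx => hR x ((le_max_left _ _).trans hx)
  have z2 : ∀ x, r ≤ |x| → deriv φ x = 0 := fun x hx => hR' x ((le_max_right _ _).trans hx)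
  rw [integral_eq_intervalIntegral (a := -r) (b := r) fun x hx => by
      rw [z2 x (hout x hx), mul_zero],
    integral_eq_intervalIntegral (a := -r) (b := r) fun x hx => by
      rw [z1 x (hout x hx), mul_zero]]
  have acP := (hii (-r) r).absolutelyContinuousOnInterval_intervalIntegral (c := 0)
    (by rw [uIcc_of_le (by linarith)]; exact ⟨by linarith, hr0.le⟩)
  have acφ : AbsolutelyContinuousOnInterval φ (-r) r :=
    h1.contDiffOn.absolutelyContinuousOnInterval
  have acC : AbsolutelyContinuousOnInterval (fun _ : ℝ => F 0) (-r) r :=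
    contDiffOn_const.absolutelyContinuousOnInterval
  have acF : AbsolutelyContinuousOnInterval F (-r) r := by
    rw [funext h]; exact acC.add acP
  rw [acF.integral_mul_deriv_eq_deriv_mul acφ, z1 r (le_abs_self r),
    z1 (-r) (by rw [abs_neg]; exact le_abs_self r)]
  rw [mul_zero, mul_zero, sub_zero, zero_sub, neg_inj]
  refine intervalIntegral.integral_congr_ae ?_
  filter_upwards [_root_.LocallyIntegrable.ae_hasDerivAt_integral hg] with x hx _
  have : HasDerivAt F (g x) x := by
    rw [funext h]; exact (hx 0).const_add (F 0)
  rw [this.deriv]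

/-- A locally integrable function with vanishing weak derivative is constant. -/
theorem ae_eq_const_of_integral_mul_deriv_eq_zero {w : ℝ → ℝ} (hw : LocallyIntegrable w)
    (h : ∀ φ : ℝ → ℝ, ContDiff ℝ 1 φ → HasCompactSupport φ → ∫ x, w x * deriv φ x = 0) :
    ∃ c : ℝ, ∀ᵐ x, w x = c := by
  let B : ContDiffBump (0:ℝ) := default
  set ρ : ℝ → ℝ := B.normed volume with hρ
  have hρc : Continuous ρ := B.continuous_normed
  have hρs : HasCompactSupport ρ := B.hasCompactSupport_normed
  have hρ1 : ∫ x, ρ x = 1 := B.integral_normed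
  refine ⟨∫ x, w x * ρ x, ae_eq_of_integral_contDiff_smul_eq hw (locallyIntegrable_const _)
    fun ψ ψ1 ψ2 => ?_⟩
  have ψc : Continuous ψ := ψ1.continuous
  -- Subtracting a multiple of `ρ` makes the integral zero, so that `k` has a compactly supported
  -- primitive, which is an admissible test function.
  set k : ℝ → ℝ := fun x => ψ x - (∫ y, ψ y) * ρ x with hk
  have hkc : Continuous k := by fun_prop
  have hks : HasCompactSupport k := ψ2.sub (hρs.mul_left (f := fun _ => ∫ y, ψ y))
  have iψ : Integrable ψ := ψc.integrable_of_hasCompactSupport ψ2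
  have iρ : Integrable ρ := hρc.integrable_of_hasCompactSupport hρs
  have hk0 : ∫ x, k x = 0 := by
    rw [hk, integral_sub iψ (iρ.const_mul _), integral_const_mul, hρ1]; ring
  obtain ⟨R, hR0, hR⟩ := exists_eq_zero_of_hasCompactSupport hks
  set P : ℝ → ℝ := fun x => ∫ y in -R..x, k y with hP
  have hPd : ∀ x, HasDerivAt P (k x) x := fun x =>
    (hkc.integral_hasStrictDerivAt (-R) x).hasDerivAt
  have hPe : deriv P = k := funext fun x => (hPd x).deriv
  have hP1 : ContDiff ℝ 1 P := by
    rw [contDiff_one_iff_deriv]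
    exact ⟨fun x => (hPd x).differentiableAt, by rw [hPe]; exact hkc⟩
  have hPs : HasCompactSupport P := by
    refine HasCompactSupport.of_support_subset_isCompact (K := Icc (-R) R) isCompact_Icc ?_
    intro x hx
    by_contra hx'
    refine hx ?_
    simp only [mem_Icc, not_and_or, not_le] at hx'
    rcases hx' with hlt | hlt
    · refine intervalIntegral.integral_zero_ae (Eventually.of_forall fun y hy => hR y ?_)
      rw [uIoc_of_ge hlt.le] at hy
      linarith [hy.2, neg_le_abs y]
    · rw [hP, ← hk0]
      refine (integral_eq_intervalIntegral fun y hy => hR y ?_).symm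
      by_contra hy'
      have := abs_lt.1 (not_le.1 hy')
      exact hy ⟨this.1, this.2.trans hlt⟩
  have key := h P hP1 hPs
  rw [hPe] at key
  have i1 : Integrable (fun x => w x * ψ x) := by
    simpa [smul_eq_mul, mul_comm] using hw.integrable_smul_left_of_hasCompactSupport ψc ψ2
  have i2 : Integrable (fun x => w x * ρ x) := by
    simpa [smul_eq_mul, mul_comm] using hw.integrable_smul_left_of_hasCompactSupport hρc hρs
  have e : ∫ x, w x * k x = (∫ x, w x * ψ x) - (∫ y, ψ y) * ∫ x, w x * ρ x := by
    rw [← integral_const_mul, ← integral_sub i1 (i2.const_mul _)]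
    congr 1; ext x; simp only [hk]; ring
  rw [e] at key
  simp only [smul_eq_mul]
  rw [integral_mul_const]
  simp only [mul_comm (ψ _)]
  linarith

theorem averages_congr {f F : ℝ → ℝ} (h : ∀ᵐ x, f x = F x) (x : ℝ) :
    averages f x = averages F x := by
  have : ∀ a b : ℝ, ∫ y in a..b, f y = ∫ y in a..b, F y := fun a b =>
    intervalIntegral.integral_congr_ae (h.mono fun y hy _ => hy)
  simp only [averages, this]

/-- The continuous representative of an even weakly differentiable function that is nonincreasing
on `(0, ∞)`. -/
theorem HasWeakDeriv.exists_bell {f q : ℝ → ℝ} (he : Function.Even f)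
    (ha : AntitoneOn f (Ioi 0)) (hf : HasWeakDeriv f q) :
    ∃ F : ℝ → ℝ, Bell F ∧ HasWeakDeriv F q ∧ ∀ᵐ x, f x = F x := by
  have hq := hf.locallyIntegrable_deriv
  set P : ℝ → ℝ := fun x => ∫ y in (0:ℝ)..x, q y with hP
  have hP0 : P 0 = 0 := intervalIntegral.integral_same
  have hPw : HasWeakDeriv P q := hasWeakDeriv_of_integral hq fun x => by rw [hP0, zero_add]
  have hPc : Continuous P := intervalIntegral.continuous_primitive (fun a b =>
    (hq.integrableOn_isCompact isCompact_uIcc).intervalIntegrable) 0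
  obtain ⟨c, hc⟩ := ae_eq_const_of_integral_mul_deriv_eq_zero
    (w := fun x => f x - P x) (hf.locallyIntegrable.sub hPw.locallyIntegrable) (by
      intro φ h1 h2
      have dc : Continuous (deriv φ) := h1.continuous_deriv le_rfl
      have i1 : Integrable (fun x => f x * deriv φ x) := by
        simpa [smul_eq_mul, mul_comm] using
          hf.locallyIntegrable.integrable_smul_left_of_hasCompactSupport dc h2.deriv
      have i2 : Integrable (fun x => P x * deriv φ x) := by
        simpa [smul_eq_mul, mul_comm] using
          hPw.locallyIntegrable.integrable_smul_left_of_hasCompactSupport dc h2.deriv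
      simp only [sub_mul]
      rw [integral_sub i1 i2, hf.integral_mul_deriv φ h1 h2, hPw.integral_mul_deriv φ h1 h2,
        sub_self])
  set F : ℝ → ℝ := fun x => c + P x with hF
  have hFc : Continuous F := continuous_const.add hPc
  have hae : ∀ᵐ x, f x = F x := hc.mono fun x hx => by simp only [hF]; linarith
  -- A full-measure set meets every interval to the right of `x`; this transfers monotonicity from
  -- `f` to `F` by continuity.
  have pick : ∀ (x : ℝ) (p : ℝ → Prop), (∀ᶠ z in 𝓝[>] x, p z) →
      ∃ z, x < z ∧ f z = F z ∧ p z := by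
    intro x p hp
    obtain ⟨u, hu, hsub⟩ := mem_nhdsGT_iff_exists_Ioo_subset.1 hp
    have hu' : x < u := hu
    have hpos : (volume : Measure ℝ) (Ioo x u) ≠ 0 := by
      rw [Real.volume_Ioo]; simpa using hu'
    have hfr : ∃ᵐ z ∂(volume : Measure ℝ), z ∈ Ioo x u := frequently_ae_mem_iff.2 hpos
    obtain ⟨z, hz1, hz2⟩ := (hfr.and_eventually hae).exists
    exact ⟨z, hz1.1, hz2, hsub hz1⟩
  refine ⟨F, ⟨hFc, ?_, ?_⟩, hasWeakDeriv_of_integral hq fun x => by simp [hF, hP], hae⟩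
  · have h1 : ∀ᵐ x : ℝ, f (-x) = F (-x) :=
      (Measure.measurePreserving_neg (volume : Measure ℝ)).quasiMeasurePreserving.ae hae
    have : (fun x => F (-x)) = F :=
      (Continuous.ae_eq_iff_eq volume (by fun_prop) hFc).1 (by
        filter_upwards [hae, h1] with x a1 a2
        rw [← a2, he x, a1])
    exact fun x => congrFun this x
  · intro x hx y hy hxy
    rcases hxy.eq_or_lt with rfl | hxy
    · exact le_rfl
    by_contra hlt
    rw [not_le] at hlt
    obtain ⟨s, hs1, hs2, hs3, hs4⟩ := pick x (fun z => F z < F y ∧ z < y)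
      (nhdsWithin_le_nhds ((hFc.continuousAt.eventually_lt_const hlt).and
        (eventually_lt_nhds hxy)))
    obtain ⟨t, ht1, ht2, ht3⟩ := pick y (fun z => F s < F z)
      (nhdsWithin_le_nhds (hFc.continuousAt.eventually_const_lt hs3))
    have hx0 : (0:ℝ) ≤ x := hx
    have := ha (a := s) (b := t) (hx0.trans_lt hs1) (hx0.trans_lt (hs1.trans (hs4.trans ht1)))
      (hs4.trans ht1).le
    rw [hs2, ht2] at this
    linarith

/-- The maximal function of a bell is weakly differentiable. -/
theorem Bell.hasWeakDeriv_maximalFunction {f : ℝ → ℝ} (hf : Bell f) :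
    HasWeakDeriv (maximalFunction f) (deriv (maximalFunction f)) := by
  set M := maximalFunction f with hM
  have hMc : Continuous M := hf.continuous_maximalFunction
  have hodd : ∀ x, deriv M (-x) = -deriv M x := by
    intro x
    have e : (fun x => M (-x)) = M := funext hf.even_maximalFunction
    have := deriv_comp_neg M x
    rw [e] at this
    rw [this, neg_neg]
  -- Monotonicity gives integrability of the derivative up to `0`, where the local Lipschitz bounds
  -- degenerate.
  have hpos : ∀ b, 0 ≤ b → IntervalIntegrable (deriv M) volume 0 b := by
    intro b hb
    have : MonotoneOn (-M) (uIcc 0 b) := by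
      rw [uIcc_of_le hb]
      exact (hf.antitoneOn_maximalFunction.mono Icc_subset_Ici_self).neg
    have := this.intervalIntegrable_deriv.neg
    refine this.congr fun x _ => ?_
    simp
  have hneg : ∀ b, 0 ≤ b → IntervalIntegrable (deriv M) volume (-b) 0 := by
    intro b hb
    have := ((IntervalIntegrable.iff_comp_neg (by simp)).1 (hpos b hb)).neg.symm
    rw [neg_zero] at this
    refine this.congr fun x _ => ?_
    simp only [Pi.neg_apply, hodd, neg_neg]
  have hloc : LocallyIntegrable (deriv M) := by
    rw [locallyIntegrable_iff]
    intro k hk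
    obtain ⟨r, hr⟩ := hk.isBounded.subset_closedBall 0
    have hii : IntervalIntegrable (deriv M) volume (-(|r| + 1)) (|r| + 1) :=
      (hneg _ (by positivity)).trans (hpos _ (by positivity))
    rw [intervalIntegrable_iff_integrableOn_Ioc_of_le (by linarith [abs_nonneg r])] at hii
    refine hii.mono_set fun x hx => ?_
    have := hr hx
    rw [mem_closedBall_zero_iff, Real.norm_eq_abs] at this
    have h2 := abs_le.1 (this.trans (le_abs_self r))
    exact ⟨by linarith [h2.1], by linarith [h2.2]⟩
  have hii : ∀ a b, IntervalIntegrable (deriv M) volume a b := fun a b =>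
    (hloc.integrableOn_isCompact isCompact_uIcc).intervalIntegrable
  have hPc := intervalIntegral.continuous_primitive hii 0
  -- On `[a, x]` with `a > 0` the function is Lipschitz and the fundamental theorem applies; `a → 0`
  -- uses continuity of `M` at `0`.
  have key : ∀ x, 0 ≤ x → M x = M 0 + ∫ y in (0:ℝ)..x, deriv M y := by
    intro x hx
    rcases hx.eq_or_lt with rfl | hx
    · simp
    have t : Tendsto (fun a => M a + ((∫ y in (0:ℝ)..x, deriv M y) - ∫ y in (0:ℝ)..a, deriv M y))
        (𝓝[>] 0) (𝓝 (M 0 + ((∫ y in (0:ℝ)..x, deriv M y) - ∫ y in (0:ℝ)..0, deriv M y))) :=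
      ((hMc.add (continuous_const.sub hPc)).tendsto 0).mono_left nhdsWithin_le_nhds
    have t2 : Tendsto (fun a => M a + ((∫ y in (0:ℝ)..x, deriv M y) - ∫ y in (0:ℝ)..a, deriv M y))
        (𝓝[>] 0) (𝓝 (M x)) := by
      refine tendsto_const_nhds.congr' ?_
      filter_upwards [Ioo_mem_nhdsGT hx] with a ha
      rw [intervalIntegral.integral_interval_sub_left (hii _ _) (hii _ _)]
      have ac : AbsolutelyContinuousOnInterval M a x := by
        refine LipschitzOnWith.absolutelyContinuousOnInterval
          (K := Real.toNNReal ((f 0 - f x) / a)) ?_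
        rw [uIcc_of_le ha.2.le]
        exact hf.lipschitzOnWith_maximalFunction ha.1
      rw [ac.integral_deriv_eq_sub]; ring
    have := tendsto_nhds_unique t2 t
    simpa using this
  refine hasWeakDeriv_of_integral hloc fun x => ?_
  rcases le_total 0 x with hx | hx
  · exact key x hx
  · have h1 := key (-x) (by linarith)
    have h2 := intervalIntegral.integral_comp_neg (a := 0) (b := -x) (deriv M)
    simp only [hodd, neg_neg, neg_zero, intervalIntegral.integral_neg] at h2
    rw [intervalIntegral.integral_symm x 0, ← h2]
    rw [neg_neg, ← h1]
    exact (hf.even_maximalFunction x).symm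

/-! ### Bounds for the first and second derivative of the maximal function. -/

namespace Bell

variable {f q : ℝ → ℝ} {V : ℝ}

/-- Testing the weak derivative against a smoothed hat function. -/
theorem sub_le_of_varBound (hf : Bell f) (hw : HasWeakDeriv f q) (hV : VarBound q V) {y : ℝ}
    (hy : 0 < y) : f 0 - f y ≤ V / 2 * y := by
  by_contra hlt
  rw [not_le] at hlt
  set k : ℝ → ℝ := fun x => 2 * f x - f (x - y) - f (x + y) with hk
  have hfc := hf.cont
  have hkc : Continuous k := by fun_prop
  have hk0 : y * V < k 0 := by
    simp only [hk, zero_sub, zero_add, hf.even y]; linarith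
  obtain ⟨m, hm1, hm2⟩ := exists_between hk0
  obtain ⟨δ, hδ, hball⟩ := Metric.eventually_nhds_iff_ball.1
    (hkc.continuousAt.eventually_const_lt hm2)
  let B : ContDiffBump (0:ℝ) := ⟨δ / 2, δ, by positivity, by linarith⟩
  set ρ : ℝ → ℝ := B.normed volume with hρ
  have hρc : Continuous ρ := B.continuous_normed
  have hρs : HasCompactSupport ρ := B.hasCompactSupport_normed
  have hρ1 : ∫ x, ρ x = 1 := B.integral_normed
  have hρn : ∀ x, 0 ≤ ρ x := B.nonneg_normed
  have hρ0 : ∀ x, x ∉ Metric.ball (0:ℝ) δ → ρ x = 0 := fun x hx => by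
    have := B.support_normed_eq (μ := volume)
    by_contra h
    exact hx (this ▸ (show x ∈ Function.support (B.normed volume) from h))
  have hρ0' : ∀ x, x ∉ Ioo (-δ) δ → ρ x = 0 := fun x hx => hρ0 x (by
    rwa [Real.ball_eq_Ioo, zero_sub, zero_add])
  have iρ : Integrable ρ := hρc.integrable_of_hasCompactSupport hρs
  set R : ℝ → ℝ := fun x => ∫ z in -δ..x, ρ z with hR
  have hRd : ∀ x, HasDerivAt R (ρ x) x := fun x =>
    (hρc.integral_hasStrictDerivAt (-δ) x).hasDerivAt
  have hRc : Continuous R := continuous_iff_continuousAt.2 fun x => (hRd x).continuousAt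
  have hRneg : ∀ x ≤ -δ, R x = 0 := fun x hx => by
    refine intervalIntegral.integral_zero_ae (Eventually.of_forall fun z hz => hρ0' z ?_)
    rw [uIoc_of_ge hx] at hz
    exact fun h => absurd h.1 (not_lt.2 hz.2)
  have hRpos : ∀ x, δ ≤ x → R x = 1 := fun x hx => by
    rw [← hρ1]
    refine (integral_eq_intervalIntegral fun z hz => hρ0' z fun h => hz ?_).symm
    exact ⟨h.1, h.2.trans_le hx⟩
  have hRmono : Monotone R := monotone_of_deriv_nonneg (fun x => (hRd x).differentiableAt)
    fun x => by rw [(hRd x).deriv]; exact hρn x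
  have hR0 : ∀ x, 0 ≤ R x := fun x => by
    rw [← hRneg (min x (-δ)) (min_le_right _ _)]; exact hRmono (min_le_left _ _)
  have hR1 : ∀ x, R x ≤ 1 := fun x => by
    rw [← hRpos (max x δ) (le_max_right _ _)]; exact hRmono (le_max_left _ _)
  set Q : ℝ → ℝ := fun x => ∫ z in -δ..x, R z with hQ
  have hQd : ∀ x, HasDerivAt Q (R x) x := fun x =>
    (hRc.integral_hasStrictDerivAt (-δ) x).hasDerivAt
  have hQneg : ∀ x ≤ -δ, Q x = 0 := fun x hx => by
    refine intervalIntegral.integral_zero_ae (Eventually.of_forall fun z hz => hRneg z ?_)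
    rw [uIoc_of_ge hx] at hz
    exact hz.2
  have hQpos : ∀ x, δ ≤ x → Q x = Q δ + (x - δ) := fun x hx => by
    simp only [hQ]
    rw [← intervalIntegral.integral_add_adjacent_intervals
      (hRc.intervalIntegrable (-δ) δ) (hRc.intervalIntegrable δ x), add_right_inj,
      intervalIntegral.integral_congr (g := fun _ => (1:ℝ))]
    · simp
    · intro z hz
      rw [uIcc_of_le hx] at hz
      exact hRpos z hz.1
  have hQs : ∀ x, 0 ≤ Q (x + y) - Q x ∧ Q (x + y) - Q x ≤ y := fun x => by
    have e : Q (x + y) - Q x = ∫ z in x..(x + y), R z :=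
      intervalIntegral.integral_interval_sub_left (hRc.intervalIntegrable _ _)
        (hRc.intervalIntegrable _ _)
    rw [e]
    constructor
    · exact intervalIntegral.integral_nonneg (by linarith) fun z _ => hR0 z
    · simpa using integral_le_mul hRc (by linarith : x ≤ x + y) fun z _ => hR1 z
  let X' : ℝ → ℝ := fun x => 2 * R x - R (x + y) - R (x - y)
  -- With `Q` a smoothing of `max x 0`, this is minus a smoothed hat of height at most `y`, and
  -- testing `q` against it yields a smoothed `2 f 0 - f (-y) - f y`.
  let X : ℝ → ℝ := fun x => 2 * Q x - Q (x + y) - Q (x - y)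
  have hXd : ∀ x, HasDerivAt X (X' x) x := fun x =>
    (((hQd x).const_mul 2).sub ((hQd (x + y)).comp_add_const x y)).sub
      ((hQd (x - y)).comp_sub_const x y)
  have hX'd : ∀ x, HasDerivAt X' (2 * ρ x - ρ (x + y) - ρ (x - y)) x := fun x =>
    (((hRd x).const_mul 2).sub ((hRd (x + y)).comp_add_const x y)).sub
      ((hRd (x - y)).comp_sub_const x y)
  have hXe : deriv X = X' := funext fun x => (hXd x).deriv
  have hX'e : deriv X' = fun x => 2 * ρ x - ρ (x + y) - ρ (x - y) :=
    funext fun x => (hX'd x).deriv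
  have hXC : ContDiff ℝ 1 X := by
    rw [contDiff_one_iff_deriv]
    exact ⟨fun x => (hXd x).differentiableAt, by rw [hXe]; fun_prop⟩
  have hX'C : ContDiff ℝ 1 X' := by
    rw [contDiff_one_iff_deriv]
    exact ⟨fun x => (hX'd x).differentiableAt, by rw [hX'e]; fun_prop⟩
  have hXs : HasCompactSupport X := by
    refine HasCompactSupport.of_support_subset_isCompact
      (K := Icc (-(y + δ)) (y + δ)) isCompact_Icc ?_
    intro x hx
    by_contra hx'
    refine hx ?_
    simp only [mem_Icc, not_and_or, not_le] at hx'
    simp only [X]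
    rcases hx' with h | h
    · rw [hQneg x (by linarith), hQneg (x + y) (by linarith), hQneg (x - y) (by linarith)]; simp
    · rw [hQpos x (by linarith), hQpos (x + y) (by linarith), hQpos (x - y) (by linarith)]; ring
  have hX's : HasCompactSupport X' := hXe ▸ hXs.deriv
  have hXb : ∀ x, |X x| ≤ y := fun x => by
    have h1 := hQs x
    have h2 := hQs (x - y)
    rw [sub_add_cancel] at h2
    simp only [X]
    exact abs_le.2 ⟨by linarith, by linarith⟩
  have t1 := hV.scale hy hXC hXs hXb
  rw [hXe, ← hw.integral_mul_deriv X' hX'C hX's, hX'e] at t1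
  have i0 : Integrable (fun x => f x * ρ x) :=
    (by fun_prop : Continuous _).integrable_of_hasCompactSupport hρs.mul_left
  have i1 : Integrable (fun x => f (x - y) * ρ x) :=
    (by fun_prop : Continuous _).integrable_of_hasCompactSupport hρs.mul_left
  have i2 : Integrable (fun x => f (x + y) * ρ x) :=
    (by fun_prop : Continuous _).integrable_of_hasCompactSupport hρs.mul_left
  have j1 : Integrable (fun x => f x * ρ (x + y)) := by simpa using i1.comp_add_right y
  have j2 : Integrable (fun x => f x * ρ (x - y)) := by simpa using i2.comp_sub_right y
  have e1 : ∫ x, f x * ρ (x + y) = ∫ x, f (x - y) * ρ x := by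
    simpa using integral_add_right_eq_self (μ := volume) (fun x => f (x - y) * ρ x) y
  have e2 : ∫ x, f x * ρ (x - y) = ∫ x, f (x + y) * ρ x := by
    simpa using integral_sub_right_eq_self (μ := volume) (fun x => f (x + y) * ρ x) y
  have e3 : ∫ x, f x * (2 * ρ x - ρ (x + y) - ρ (x - y)) = ∫ x, k x * ρ x := by
    have a1 : ∫ x, f x * (2 * ρ x - ρ (x + y) - ρ (x - y)) = 2 * (∫ x, f x * ρ x) -
        (∫ x, f x * ρ (x + y)) - ∫ x, f x * ρ (x - y) := by
      rw [← integral_const_mul, ← integral_sub (i0.const_mul 2) j1, ← integral_sub ?_ j2]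
      · congr 1; ext x; ring
      · exact (i0.const_mul 2).sub j1
    have a2 : ∫ x, k x * ρ x = 2 * (∫ x, f x * ρ x) -
        (∫ x, f (x - y) * ρ x) - ∫ x, f (x + y) * ρ x := by
      rw [← integral_const_mul, ← integral_sub (i0.const_mul 2) i1, ← integral_sub ?_ i2]
      · congr 1; ext x; simp only [hk]; ring
      · exact (i0.const_mul 2).sub i1
    rw [a1, a2, e1, e2]
  rw [e3] at t1
  have low : m * ∫ x, ρ x ≤ ∫ x, k x * ρ x := by
    rw [← integral_const_mul]
    refine integral_mono (iρ.const_mul m)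
      ((by fun_prop : Continuous _).integrable_of_hasCompactSupport hρs.mul_left) fun x => ?_
    by_cases hx : x ∈ Metric.ball (0:ℝ) δ
    · exact mul_le_mul_of_nonneg_right (hball x hx).le (hρn x)
    · simp [hρ0 x hx]
  rw [hρ1] at low
  linarith

/-- The difference bound for the maximal function involves `(f 0 - f y) / y`, which is at most `V /
2` at every scale, so there is one Lipschitz constant on all of `(0, ∞)`. -/
theorem abs_deriv_maximalFunction_le (hf : Bell f) (hw : HasWeakDeriv f q) (hV : VarBound q V)
    {x : ℝ} (hx : 0 < x) : |deriv (maximalFunction f) x| ≤ V / 2 := by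
  have hV0 : 0 ≤ V / 2 := by have := hV.nonneg; positivity
  have key : ∀ a ∈ Ioi (0:ℝ), ∀ b ∈ Ioi (0:ℝ), a ≤ b →
      |maximalFunction f a - maximalFunction f b| ≤ V / 2 * |a - b| := by
    intro a ha b hb hab
    have ha : 0 < a := ha
    have hb : 0 < b := hb
    rw [abs_of_nonneg (sub_nonneg.2 (hf.antitoneOn_maximalFunction ha.le hb.le hab)),
      abs_sub_comm, abs_of_nonneg (sub_nonneg.2 hab), mul_comm]
    refine (hf.maximalFunction_sub_le ha hab).trans ?_
    refine mul_le_mul_of_nonneg_left ?_ (sub_nonneg.2 hab)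
    rw [div_le_iff₀ hb]
    exact hf.sub_le_of_varBound hw hV hb
  have hl : LipschitzOnWith (Real.toNNReal (V / 2)) (maximalFunction f) (Ioi 0) := by
    refine LipschitzOnWith.of_dist_le_mul fun a ha b hb => ?_
    rw [Real.dist_eq, Real.dist_eq, Real.coe_toNNReal _ hV0]
    rcases le_total a b with h | h
    · exact key a ha b hb h
    · rw [abs_sub_comm, abs_sub_comm a b]; exact key b hb a ha h
  have := norm_deriv_le_of_lipschitzOn (Ioi_mem_nhds hx) hl
  rwa [Real.coe_toNNReal _ hV0] at this

/-- The negative part of the second derivative of the maximal function on `(0, ∞)` is a measure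
of mass at most `4 V`. -/
theorem neg_le_integral_deriv_maximalFunction (hf : Bell f) (hw : HasWeakDeriv f q)
    (hV : VarBound q V) {φ : ℝ → ℝ} (hφ : ContDiff ℝ 1 φ) {a b : ℝ} (ha : 0 < a) (hab : a ≤ b)
    (hs : ∀ x, x ∉ Ioo a b → φ x = 0) (h0 : ∀ x, 0 ≤ φ x) (h1 : ∀ x, φ x ≤ 1) :
    -(4 * V) ≤ -∫ x, deriv (maximalFunction f) x * deriv φ x := by
  set M := maximalFunction f with hM
  have hMc : Continuous M := hf.continuous_maximalFunction
  have hMw : HasWeakDeriv M (deriv M) := hf.hasWeakDeriv_maximalFunction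
  have hb : 0 < b := ha.trans_le hab
  have hφc : Continuous φ := hφ.continuous
  have hφ'c : Continuous (deriv φ) := hφ.continuous_deriv le_rfl
  have hφd : ∀ x, HasDerivAt φ (deriv φ x) x := fun x =>
    (hφ.differentiable one_ne_zero x).hasDerivAt
  -- The weight is chosen so that `x² θ = φ`; then `invDilDiff T ε / ε²` tends to `φ'`.
  let θ : ℝ → ℝ := fun x => φ x / (max x a) ^ 2
  have hmax : ∀ x, 0 < max x a := fun x => lt_max_of_lt_right ha
  have hθc : Continuous θ := hφc.div (by fun_prop) fun x => (pow_pos (hmax x) 2).ne'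
  have hsθ : ∀ x, x ∉ Icc a b → θ x = 0 := fun x hx => by
    simp [θ, hs x fun h => hx (Ioo_subset_Icc_self h)]
  have hθe : ∀ x, x ^ 2 * θ x = φ x := fun x => by
    rcases le_or_gt a x with h | h
    · have : x ≠ 0 := (ha.trans_le h).ne'
      simp only [θ, max_eq_left h]; field_simp
    · have : φ x = 0 := hs x fun h' => by linarith [h'.1]
      simp [θ, this]
  set T : ℝ → ℝ := fun x => ∫ y in (0:ℝ)..x, θ y with hT
  have hTd : ∀ x, HasDerivAt T (θ x) x := fun x => (hθc.integral_hasStrictDerivAt 0 x).hasDerivAt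
  have hTc : Continuous T := continuous_iff_continuousAt.2 fun x => (hTd x).continuousAt
  obtain ⟨z1, z2⟩ := integral_eq_zero_or_const ha hθc hsθ
  have step : ∀ ε ∈ Ioc (0:ℝ) (1 / 2),
      -(4 * V) ≤ -∫ x, deriv M x * (invDilDiff T ε x / ε ^ 2) := by
    rintro ε ⟨hε, hε1⟩
    have k1 := hMw.integral_dilDiff_mul hMc ha hb hθc hsθ hε hε1
    have hdf := continuous_dilDiff hf.cont ε
    have hdM := continuous_dilDiff hMc ε
    have k2 := integral_primitive_div_cube_le (h := fun y => |dilDiff f ε y|)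
      hdf.abs (fun _ => abs_nonneg _)
      (fun c d hc hcd => hV.integral_abs_dilDiff_le hw hf.cont hc hcd hε hε1) ha hab
    have hHc : Continuous fun x => ∫ y in (0:ℝ)..x, |dilDiff f ε y| :=
      intervalIntegral.continuous_primitive (fun _ _ => hdf.abs.intervalIntegrable _ _) 0
    have k3 : -(∫ x in a..b, 2 * (∫ y in (0:ℝ)..x, |dilDiff f ε y|) / x ^ 3) ≤
        ∫ x in a..b, dilDiff M ε x * θ x := by
      rw [← intervalIntegral.integral_neg]
      refine intervalIntegral.integral_mono_on hab ?_ ?_ ?_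
      · refine ContinuousOn.intervalIntegrable fun x hx => ?_
        rw [uIcc_of_le hab] at hx
        have : x ≠ 0 := (ha.trans_le hx.1).ne'
        exact ContinuousAt.continuousWithinAt
          (ContinuousAt.div (by fun_prop) (by fun_prop) (by positivity)).neg
      · exact (hdM.mul hθc).intervalIntegrable _ _
      · intro x hx
        have hx0 : 0 < x := ha.trans_le hx.1
        have hd := hf.dilDiff_maximalFunction_ge hx0 hε hε1
        set N := ∫ y in (0:ℝ)..x, |dilDiff f ε y| with hN
        have hN0 : 0 ≤ N := intervalIntegral.integral_nonneg hx0.le fun _ _ => abs_nonneg _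
        have e1 : θ x = φ x / x ^ 2 := by simp only [θ, max_eq_left hx.1]
        have hθ0 : 0 ≤ θ x := by rw [e1]; exact div_nonneg (h0 x) (by positivity)
        have hθ1 : θ x ≤ 1 / x ^ 2 := by rw [e1]; gcongr; exact h1 x
        have s1 : -(2 * N) / x * θ x ≤ dilDiff M ε x * θ x :=
          mul_le_mul_of_nonneg_right hd hθ0
        have s2 : 2 * N / x * θ x ≤ 2 * N / x * (1 / x ^ 2) :=
          mul_le_mul_of_nonneg_left hθ1 (by positivity)
        have s3 : 2 * N / x * (1 / x ^ 2) = 2 * N / x ^ 3 := by field_simp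
        have s4 : -(2 * N) / x * θ x = -(2 * N / x * θ x) := by ring
        linarith
    have k4 : ∫ x, dilDiff M ε x * θ x = ∫ x in a..b, dilDiff M ε x * θ x :=
      integral_eq_intervalIntegral fun x hx => by
        have : θ x = 0 := by simp [θ, hs x hx]
        rw [this, mul_zero]
    have e : ∫ x, deriv M x * (invDilDiff T ε x / ε ^ 2) =
        (∫ x, deriv M x * invDilDiff T ε x) / ε ^ 2 := by
      rw [← integral_div]; congr 1; ext x; ring
    rw [e, ← neg_div, ← k1, k4, le_div_iff₀ (by positivity)]
    linarith
  have hsc : HasCompactSupport φ :=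
    HasCompactSupport.of_support_subset_isCompact (K := Icc a b) isCompact_Icc fun x hx => by
      by_contra hx'; exact hx (hs x fun h => hx' (Ioo_subset_Icc_self h))
  obtain ⟨D, hD⟩ := hφ'c.bounded_above_of_compact_support hsc.deriv
  have hD0 : 0 ≤ D := (norm_nonneg _).trans (hD 0)
  have hzneg : ∀ x ≤ 0, ∀ ε ∈ Ioc (0:ℝ) (1 / 2), invDilDiff T ε x = 0 := by
    rintro x hx ε ⟨hε, hε1⟩
    have e1 : x / (1 + ε) ≤ a := (div_nonpos_of_nonpos_of_nonneg hx (by linarith)).trans ha.le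
    have e2 : x / (1 - ε) ≤ a := (div_nonpos_of_nonpos_of_nonneg hx (by linarith)).trans ha.le
    simp only [invDilDiff, hT, z1 _ e1, z1 _ e2, z1 x (by linarith)]; simp
  have hder1 : ∀ x, 0 < x → ∀ l, 0 < l →
      HasDerivAt (fun l => T (x / l)) (-φ (x / l) / x) l := by
    intro x hx l hl
    have d : HasDerivAt (fun l => x / l) (-x / l ^ 2) l := by
      simpa [div_eq_mul_inv] using (hasDerivAt_inv hl.ne').const_mul x
    refine ((hTd (x / l)).comp l d).congr_deriv ?_
    rw [← hθe (x / l)]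
    field_simp
  have hder2 : ∀ x, 0 < x → ∀ l, 0 < l →
      HasDerivAt (fun l => -φ (x / l) / x) (deriv φ (x / l) / l ^ 2) l := by
    intro x hx l hl
    have d : HasDerivAt (fun l => x / l) (-x / l ^ 2) l := by
      simpa [div_eq_mul_inv] using (hasDerivAt_inv hl.ne').const_mul x
    refine (((hφd (x / l)).comp l d).neg.div_const x).congr_deriv ?_
    field_simp
  -- Domination uniform in `ε`: the second derivative in `l` is `φ' (x / l) / l²`, at most `4 D` for
  -- `l ≥ 1 / 2`, and everything vanishes past `2 b` since `1 + ε < 2`.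
  have hbound : ∀ ε ∈ Ioc (0:ℝ) (1 / 2), ∀ x,
      |invDilDiff T ε x| ≤ (Icc 0 (2 * b)).indicator (fun _ => 8 * D) x * ε ^ 2 := by
    rintro ε ⟨hε, hε1⟩ x
    by_cases hx : x ∈ Icc 0 (2 * b)
    · rw [indicator_of_mem hx]
      rcases hx.1.eq_or_lt with h | hx0
      · rw [← h, hzneg 0 le_rfl ε ⟨hε, hε1⟩, abs_zero]; positivity
      have := abs_symm_diff_le (G := fun l => T (x / l)) (G' := fun l => -φ (x / l) / x)
        (G'' := fun l => deriv φ (x / l) / l ^ 2) (ε := ε) (K := 4 * D) hε.le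
        (fun l hl => hder1 x hx0 l (by linarith [hl.1]))
        (fun l hl => hder2 x hx0 l (by linarith [hl.1]))
        (fun l hl => by
          have hl0 : 1 / 2 ≤ l := by linarith [hl.1]
          have hl1 : 1 / 4 ≤ l ^ 2 := by nlinarith
          rw [abs_div, abs_of_pos (by positivity : 0 < l ^ 2), div_le_iff₀ (by positivity)]
          have := hD (x / l)
          rw [Real.norm_eq_abs] at this
          nlinarith)
      rw [div_one] at this
      refine this.trans_eq ?_
      ring
    · rw [indicator_of_notMem hx, zero_mul]
      refine le_of_eq (abs_eq_zero.2 ?_)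
      simp only [mem_Icc, not_and_or, not_le] at hx
      rcases hx with h | h
      · exact hzneg x h.le ε ⟨hε, hε1⟩
      · have e1 : b ≤ x / (1 + ε) := by rw [le_div_iff₀ (by linarith)]; nlinarith
        have e2 : b ≤ x / (1 - ε) := by rw [le_div_iff₀ (by linarith)]; nlinarith
        simp only [invDilDiff, hT, z2 _ e1, z2 _ e2, z2 x (by linarith)]; ring
  have hev : ∀ᶠ ε : ℝ in 𝓝[>] 0, ε ∈ Ioc (0:ℝ) (1 / 2) := Ioc_mem_nhdsGT (by norm_num)
  have lim : Tendsto (fun ε => ∫ x, deriv M x * (invDilDiff T ε x / ε ^ 2)) (𝓝[>] 0)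
      (𝓝 (∫ x, deriv M x * deriv φ x)) := by
    refine tendsto_integral_filter_of_dominated_convergence
      (fun x => (Icc 0 (2 * b)).indicator (fun x => |deriv M x| * (8 * D)) x) ?_ ?_ ?_ ?_
    · refine Eventually.of_forall fun ε => ?_
      refine hMw.locallyIntegrable_deriv.aestronglyMeasurable.mul
        (Continuous.aestronglyMeasurable ?_)
      unfold invDilDiff; fun_prop
    · filter_upwards [hev] with ε hε
      refine Eventually.of_forall fun x => ?_
      have hp : 0 < ε ^ 2 := pow_pos hε.1 2
      rw [Real.norm_eq_abs, abs_mul, abs_div, abs_of_pos hp]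
      have := hbound ε hε x
      rw [← div_le_iff₀ hp] at this
      refine (mul_le_mul_of_nonneg_left this (abs_nonneg _)).trans_eq ?_
      by_cases hx : x ∈ Icc 0 (2 * b) <;> simp [hx]
    · rw [integrable_indicator_iff measurableSet_Icc]
      exact (hMw.locallyIntegrable_deriv.integrableOn_isCompact isCompact_Icc).abs.mul_const _
    · refine Eventually.of_forall fun x => Tendsto.const_mul _ ?_
      rcases le_or_gt x 0 with hx | hx
      · have hφ0 : deriv φ x = 0 := by
          have : φ =ᶠ[𝓝 x] fun _ => 0 := by
            filter_upwards [Iio_mem_nhds (hx.trans_lt ha)] with z hz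
            exact hs z fun h => absurd h.1 (not_lt.2 (le_of_lt hz))
          rw [this.deriv_eq, deriv_const]
        rw [hφ0]
        refine tendsto_const_nhds.congr' ?_
        filter_upwards [hev] with ε hε
        rw [hzneg x hx ε hε, zero_div]
      · have := tendsto_symm_diff_div (G := fun l => T (x / l)) (G' := fun l => -φ (x / l) / x)
          (k := deriv φ x)
          (by filter_upwards [Ioi_mem_nhds zero_lt_one] with l hl using hder1 x hx l hl)
          (by simpa using hder2 x hx 1 one_pos)
        simpa [invDilDiff] using this
  refine ge_of_tendsto lim.neg ?_
  filter_upwards [hev] with ε hε using step ε hε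

end Bell

/-! ### From the negative part to the full variation. -/

/-- A function on `(0, ∞)` that is bounded and whose derivative has bounded negative part has
bounded variation there, tested against functions that need not vanish at `0`. -/
theorem neg_integral_mul_deriv_le {g : ℝ → ℝ} {L N : ℝ} (hg : LocallyIntegrable g) (hL : 0 ≤ L)
    (hb : ∀ x, 0 < x → |g x| ≤ L)
    (hN : ∀ φ : ℝ → ℝ, ContDiff ℝ 1 φ → ∀ a b : ℝ, 0 < a → a ≤ b →
      (∀ x, x ∉ Ioo a b → φ x = 0) → (∀ x, 0 ≤ φ x) → (∀ x, φ x ≤ 1) →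
      -N ≤ -∫ x, g x * deriv φ x)
    {Φ : ℝ → ℝ} (hΦ : ContDiff ℝ 1 Φ) (hΦ2 : ∀ x, |Φ x| ≤ 2) {R : ℝ} (hR : 1 < R)
    (hs : ∀ x, R ≤ |x| → Φ x = 0) :
    -∫ x in (0:ℝ)..(R + 1), g x * deriv Φ x ≤ 4 * N + 8 * L := by
  have hΦc : Continuous Φ := hΦ.continuous
  have hΦ'c : Continuous (deriv Φ) := hΦ.continuous_deriv le_rfl
  have hsc : HasCompactSupport Φ :=
    HasCompactSupport.of_support_subset_isCompact (K := Icc (-R) R) isCompact_Icc fun x hx => by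
      by_contra hx'
      refine hx (hs x ?_)
      by_contra hlt
      exact hx' (abs_le.1 (not_le.1 hlt).le)
  obtain ⟨D, hD⟩ := hΦ'c.bounded_above_of_compact_support hsc.deriv
  have hD0 : 0 ≤ D := (norm_nonneg _).trans (hD 0)
  have hΦ'0 : ∀ x, R < x → deriv Φ x = 0 := fun x hx => by
    have : Φ =ᶠ[𝓝 x] fun _ => 0 := by
      filter_upwards [Ioi_mem_nhds hx] with z hz
      exact hs z ((le_of_lt hz).trans (le_abs_self z))
    rw [this.deriv_eq, deriv_const]
  have main : ∀ δ ∈ Ioo (0:ℝ) (1 / 2),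
      -∫ x in (0:ℝ)..(R + 1), g x * deriv Φ x ≤ 4 * N + 8 * L + L * D * (2 * δ) := by
    rintro δ ⟨hδ, hδ1⟩
    set S := Real.smoothTransition with hS
    have hSC : ContDiff ℝ 1 S := Real.smoothTransition.contDiff (n := 1)
    have hSd : ∀ x, HasDerivAt S (deriv S x) x := fun x =>
      (hSC.differentiable one_ne_zero x).hasDerivAt
    have hS'c : Continuous (deriv S) := hSC.continuous_deriv le_rfl
    have hS'0 : ∀ x, 0 ≤ deriv S x := fun x => Real.smoothTransition.monotone.deriv_nonneg
    have hS0 : ∀ x, 0 ≤ S x := Real.smoothTransition.nonneg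
    have hS1 : ∀ x, S x ≤ 1 := Real.smoothTransition.le_one
    have hSz : ∀ x ≤ 0, S x = 0 := fun x hx => Real.smoothTransition.zero_of_nonpos hx
    have hSo : ∀ x, 1 ≤ x → S x = 1 := fun x hx => Real.smoothTransition.one_of_one_le hx
    let p : ℝ → ℝ := fun x => S ((x - δ) / δ)
    let e : ℝ → ℝ := fun x => S (R + 1 - x)
    let p' : ℝ → ℝ := fun x => deriv S ((x - δ) / δ) / δ
    let e' : ℝ → ℝ := fun x => -deriv S (R + 1 - x)
    have hpd : ∀ x, HasDerivAt p (p' x) x := fun x =>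
      ((hSd _).comp x (((hasDerivAt_id x).sub_const δ).div_const δ)).congr_deriv (by
        simp only [p', id_eq]; ring)
    have hed : ∀ x, HasDerivAt e (e' x) x := fun x =>
      ((hSd _).comp x ((hasDerivAt_id x).const_sub (R + 1))).congr_deriv (by
        simp only [e', id_eq]; ring)
    have hpc : Continuous p := continuous_iff_continuousAt.2 fun x => (hpd x).continuousAt
    have hec : Continuous e := continuous_iff_continuousAt.2 fun x => (hed x).continuousAt
    have hp'c : Continuous p' := by fun_prop
    have he'c : Continuous e' := by fun_prop
    have hp'0 : ∀ x, 0 ≤ p' x := fun x => div_nonneg (hS'0 _) hδ.le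
    have he'0 : ∀ x, e' x ≤ 0 := fun x => neg_nonpos.2 (hS'0 _)
    have hpz : ∀ x ≤ δ, p x = 0 := fun x hx => hSz _ (div_nonpos_of_nonpos_of_nonneg
      (by linarith) hδ.le)
    have hpo : ∀ x, 2 * δ ≤ x → p x = 1 := fun x hx => hSo _ (by
      rw [le_div_iff₀ hδ]; linarith)
    have hez : ∀ x, R + 1 ≤ x → e x = 0 := fun x hx => hSz _ (by linarith)
    have heo : ∀ x ≤ R, e x = 1 := fun x hx => hSo _ (by linarith)
    -- A cutoff rising on `[δ, 2 δ]` and falling on `[R, R + 1]`. As one of `p`, `e` is always `1`,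
    -- the expression `p + e - 1` equals their product but has a simpler derivative.
    let η : ℝ → ℝ := fun x => p x + e x - 1
    have hηr : ∀ x, 0 ≤ η x ∧ η x ≤ 1 := fun x => by
      rcases le_total x R with h | h
      · simp only [η, heo x h]
        have := hS0 ((x - δ) / δ); have := hS1 ((x - δ) / δ)
        constructor <;> simp only [p] <;> linarith
      · simp only [η, hpo x (by linarith)]
        have := hS0 (R + 1 - x); have := hS1 (R + 1 - x)
        constructor <;> simp only [e] <;> linarith
    have hη0 : ∀ x, x ∉ Ioo δ (R + 1) → η x = 0 := fun x hx => by
      simp only [mem_Ioo, not_and_or, not_lt] at hx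
      rcases hx with h | h
      · simp [η, hpz x h, heo x (by linarith)]
      · simp [η, hpo x (by linarith), hez x h]
    -- From `|Φ| ≤ 2` the factor `2 - Φ` lies in `[0, 4]`, so `φ` is admissible in `hN`; the minus
    -- sign turns that lower bound into an upper bound for `Φ`.
    let φ : ℝ → ℝ := fun x => η x * (2 - Φ x) / 4
    have hφd : ∀ x, HasDerivAt φ (((p' x + e' x) * (2 - Φ x) - η x * deriv Φ x) / 4) x := fun x =>
      (((((hpd x).add (hed x)).sub_const 1).mul
        ((hΦ.differentiable one_ne_zero x).hasDerivAt.const_sub 2)).div_const 4).congr_deriv (by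
          simp only [η, Pi.add_apply]; ring)
    have hφe : deriv φ = fun x => ((p' x + e' x) * (2 - Φ x) - η x * deriv Φ x) / 4 :=
      funext fun x => (hφd x).deriv
    have hφ'c : Continuous (deriv φ) := by rw [hφe]; fun_prop
    have hφC : ContDiff ℝ 1 φ := by
      rw [contDiff_one_iff_deriv]
      exact ⟨fun x => (hφd x).differentiableAt, hφ'c⟩
    have hφs : ∀ x, x ∉ Ioo δ (R + 1) → φ x = 0 := fun x hx => by simp [φ, hη0 x hx]
    have hΦ2' : ∀ x, 0 ≤ 2 - Φ x ∧ 2 - Φ x ≤ 4 := fun x => by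
      have := abs_le.1 (hΦ2 x)
      constructor <;> linarith
    have key := hN φ hφC δ (R + 1) hδ (by linarith) hφs
      (fun x => div_nonneg (mul_nonneg (hηr x).1 (hΦ2' x).1) (by norm_num))
      (fun x => by
        have := mul_le_mul (hηr x).2 (hΦ2' x).2 (hΦ2' x).1 zero_le_one
        simp only [φ]; linarith)
    have hφ'0 : ∀ x, x ∉ Ioo 0 (R + 1) → deriv φ x = 0 := fun x hx => by
      simp only [mem_Ioo, not_and_or, not_lt] at hx
      rcases hx with h | h
      · have : φ =ᶠ[𝓝 x] fun _ => 0 := by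
          filter_upwards [Iio_mem_nhds (h.trans_lt hδ)] with z hz
          exact hφs z fun h' => absurd h'.1 (not_lt.2 (le_of_lt hz))
        rw [this.deriv_eq, deriv_const]
      · have hz : φ x = 0 := hφs x fun h' => absurd h'.2 (not_lt.2 h)
        have hmin : IsLocalMin φ x := Eventually.of_forall fun z => by
          rw [hz]; exact div_nonneg (mul_nonneg (hηr z).1 (hΦ2' z).1) (by norm_num)
        exact hmin.deriv_eq_zero
    rw [integral_eq_intervalIntegral (a := 0) (b := R + 1) fun x hx => by
      rw [hφ'0 x hx, mul_zero]] at key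
    have gi : IntervalIntegrable g volume 0 (R + 1) :=
      (hg.integrableOn_isCompact isCompact_uIcc).intervalIntegrable
    have i1 : IntervalIntegrable (fun x => g x * deriv Φ x) volume 0 (R + 1) :=
      gi.mul_continuousOn hΦ'c.continuousOn
    have i2 : IntervalIntegrable (fun x => g x * deriv φ x) volume 0 (R + 1) :=
      gi.mul_continuousOn hφ'c.continuousOn
    have i3 : IntervalIntegrable (fun x => 4 * L * (p' x - e' x) + L * D * (1 - p x))
        volume 0 (R + 1) := Continuous.intervalIntegrable (by fun_prop) _ _
    have cmp : ∫ x in (0:ℝ)..(R + 1), -(g x * deriv Φ x) ≤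
        ∫ x in (0:ℝ)..(R + 1), (4 * (g x * deriv φ x) +
          (4 * L * (p' x - e' x) + L * D * (1 - p x))) := by
      refine intervalIntegral.integral_mono_on_of_le_Ioo (by linarith) i1.neg
        ((i2.const_mul 4).add i3) fun x hx => ?_
      have hgx := hb x hx.1
      have b1 : |(p' x + e' x) * (2 - Φ x)| ≤ 4 * (p' x - e' x) := by
        have : |p' x + e' x| ≤ p' x - e' x :=
          abs_le.2 ⟨by linarith [hp'0 x, he'0 x], by linarith [hp'0 x, he'0 x]⟩
        rw [abs_mul, abs_of_nonneg (hΦ2' x).1, mul_comm]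
        exact mul_le_mul (hΦ2' x).2 this (abs_nonneg _) (by norm_num)
      have b2 : |(1 - η x) * deriv Φ x| ≤ D * (1 - p x) := by
        have h1p : 0 ≤ 1 - p x := sub_nonneg.2 (hS1 _)
        rcases le_or_gt x R with h | h
        · have : 1 - η x = 1 - p x := by simp only [η, heo x h]; ring
          rw [this, abs_mul, abs_of_nonneg h1p, mul_comm]
          exact mul_le_mul_of_nonneg_right (hD x) h1p
        · rw [hΦ'0 x h]; simp; positivity
      have m1 : |g x * ((p' x + e' x) * (2 - Φ x))| ≤ L * (4 * (p' x - e' x)) := by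
        rw [abs_mul]; exact mul_le_mul hgx b1 (abs_nonneg _) hL
      have m2 : |g x * ((1 - η x) * deriv Φ x)| ≤ L * (D * (1 - p x)) := by
        rw [abs_mul]; exact mul_le_mul hgx b2 (abs_nonneg _) hL
      have m1' := (abs_le.1 m1).1
      have m2' := (abs_le.1 m2).1
      rw [hφe]
      simp only
      -- The first term contributes `4 N`. The second is carried by the two ramps, whose total rise
      -- and fall is `2`, giving `8 L`. The third lives on `(0, 2 δ)` and disappears as `δ → 0`.
      have eq : -(g x * deriv Φ x) =
          4 * (g x * (((p' x + e' x) * (2 - Φ x) - η x * deriv Φ x) / 4)) -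
          g x * ((p' x + e' x) * (2 - Φ x)) - g x * ((1 - η x) * deriv Φ x) := by ring
      rw [eq]
      linarith
    rw [intervalIntegral.integral_neg, intervalIntegral.integral_add (i2.const_mul 4) i3,
      intervalIntegral.integral_const_mul] at cmp
    have f1 : ∫ x in (0:ℝ)..(R + 1), (p' x - e' x) = 2 := by
      rw [intervalIntegral.integral_eq_sub_of_hasDerivAt (f := fun x => p x - e x)
        (fun x _ => (hpd x).sub (hed x)) (Continuous.intervalIntegrable (by fun_prop) _ _)]
      rw [hpo (R + 1) (by linarith), hez (R + 1) le_rfl, hpz 0 hδ.le, heo 0 (by linarith)]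
      norm_num
    have f2 : ∫ x in (0:ℝ)..(R + 1), (1 - p x) ≤ 2 * δ := by
      have hc : Continuous fun x => 1 - p x := by fun_prop
      rw [← intervalIntegral.integral_add_adjacent_intervals (b := 2 * δ)
        (hc.intervalIntegrable _ _) (hc.intervalIntegrable _ _)]
      have s1 : ∫ x in (0:ℝ)..(2 * δ), (1 - p x) ≤ 1 * (2 * δ - 0) :=
        integral_le_mul hc (by linarith) fun x _ => by
          have := hS0 ((x - δ) / δ); simp only [p]; linarith
      have s2 : ∫ x in (2 * δ)..(R + 1), (1 - p x) ≤ 0 * (R + 1 - 2 * δ) :=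
        integral_le_mul hc (by linarith) fun x hx => by rw [hpo x hx.1]; simp
      linarith
    have f3 : ∫ x in (0:ℝ)..(R + 1), (4 * L * (p' x - e' x) + L * D * (1 - p x)) =
        4 * L * 2 + L * D * ∫ x in (0:ℝ)..(R + 1), (1 - p x) := by
      rw [intervalIntegral.integral_add (Continuous.intervalIntegrable (by fun_prop) _ _)
        (Continuous.intervalIntegrable (by fun_prop) _ _), intervalIntegral.integral_const_mul,
        intervalIntegral.integral_const_mul, f1]
    have f4 := mul_le_mul_of_nonneg_left f2 (mul_nonneg hL hD0)
    rw [f3] at cmp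
    linarith
  have t : Tendsto (fun δ : ℝ => 4 * N + 8 * L + L * D * (2 * δ)) (𝓝[>] 0)
      (𝓝 (4 * N + 8 * L + L * D * (2 * 0))) :=
    ((by fun_prop : Continuous fun δ : ℝ => 4 * N + 8 * L + L * D * (2 * δ)).tendsto 0).mono_left
      nhdsWithin_le_nhds
  rw [mul_zero, mul_zero, add_zero] at t
  refine ge_of_tendsto t ?_
  filter_upwards [Ioo_mem_nhdsGT (by norm_num : (0:ℝ) < 1 / 2)] with δ hδ using main δ hδ

/-- As `g` is odd, the whole line folds onto `(0, ∞)` with the test function `φ x + φ (-x)`, bounded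
by `2` and not vanishing at `0` in general. With `N = 4 V` and `L = V / 2` the constant is `16 + 4 =
20`. -/
theorem Bell.varBound_deriv_maximalFunction {f q : ℝ → ℝ} {V : ℝ} (hf : Bell f)
    (hw : HasWeakDeriv f q) (hV : VarBound q V) :
    VarBound (deriv (maximalFunction f)) (20 * V) := by
  intro φ h1 h2 h3
  set g := deriv (maximalFunction f) with hgdef
  have hg : LocallyIntegrable g := hf.hasWeakDeriv_maximalFunction.locallyIntegrable_deriv
  have hodd : ∀ x, g (-x) = -g x := by
    intro x
    have e : (fun x => maximalFunction f (-x)) = maximalFunction f :=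
      funext hf.even_maximalFunction
    have := deriv_comp_neg (maximalFunction f) x
    rw [e] at this
    rw [hgdef, this, neg_neg]
  obtain ⟨R₀, hR₀, hs₀⟩ := exists_eq_zero_of_hasCompactSupport h2
  set R := R₀ + 1 with hR
  have hs : ∀ x, R ≤ |x| → φ x = 0 := fun x hx => hs₀ x (by linarith)
  have hφ'0 : ∀ x, R₀ < |x| → deriv φ x = 0 := fun x hx => by
    have : φ =ᶠ[𝓝 x] fun _ => 0 := by
      filter_upwards [continuous_abs.continuousAt.eventually_const_lt hx] with z hz
      exact hs₀ z hz.le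
    rw [this.deriv_eq, deriv_const]
  let Φ : ℝ → ℝ := fun x => φ x + φ (-x)
  have hΦ : ContDiff ℝ 1 Φ := h1.add (h1.comp contDiff_neg)
  have hΦd : ∀ x, deriv Φ x = deriv φ x - deriv φ (-x) := fun x => by
    have d := (h1.differentiable one_ne_zero x).hasDerivAt
    have d2 := ((h1.differentiable one_ne_zero (-x)).hasDerivAt.comp x (hasDerivAt_neg x))
    have := (d.add d2).deriv
    rw [mul_neg_one, ← sub_eq_add_neg] at this
    exact this
  have key := neg_integral_mul_deriv_le hg (by have := hV.nonneg; positivity : 0 ≤ V / 2)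
    (fun x hx => hf.abs_deriv_maximalFunction_le hw hV hx)
    (fun ψ hψ a b ha hab hs h0 h1 =>
      hf.neg_le_integral_deriv_maximalFunction hw hV hψ ha hab hs h0 h1) hΦ
    (fun x => by
      have a1 := abs_le.1 (h3 x)
      have a2 := abs_le.1 (h3 (-x))
      exact abs_le.2 ⟨by simp only [Φ]; linarith, by simp only [Φ]; linarith⟩)
    (R := R) (by linarith) (fun x hx => by
      simp only [Φ, hs x hx, hs (-x) (by rwa [abs_neg]), add_zero])
  have hφ'c : Continuous (deriv φ) := h1.continuous_deriv le_rfl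
  have hii : ∀ a b, IntervalIntegrable g volume a b := fun a b =>
    (hg.integrableOn_isCompact isCompact_uIcc).intervalIntegrable
  have eq : ∫ x, g x * deriv φ x = ∫ x in (0:ℝ)..(R + 1), g x * deriv Φ x := by
    rw [integral_eq_intervalIntegral (a := -(R + 1)) (b := R + 1) fun x hx => by
      rw [hφ'0 x ?_, mul_zero]
      by_contra hlt
      have := abs_le.1 (not_lt.1 hlt)
      exact hx ⟨by linarith [this.1], by linarith [this.2]⟩]
    have i1 : ∀ a b, IntervalIntegrable (fun x => g x * deriv φ x) volume a b := fun a b =>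
      (hii a b).mul_continuousOn hφ'c.continuousOn
    have i2 : ∀ a b, IntervalIntegrable (fun x => g x * deriv φ (-x)) volume a b := fun a b =>
      (hii a b).mul_continuousOn (hφ'c.comp continuous_neg).continuousOn
    rw [← intervalIntegral.integral_add_adjacent_intervals (i1 _ 0) (i1 0 _)]
    have hrefl := intervalIntegral.integral_comp_neg (a := 0) (b := R + 1)
      (fun x => g x * deriv φ x)
    rw [neg_zero] at hrefl
    rw [← hrefl]
    simp only [hodd, neg_mul, intervalIntegral.integral_neg, hΦd, mul_sub]
    rw [intervalIntegral.integral_sub (i1 _ _) (i2 _ _)]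
    ring
  rw [eq]
  linarith

theorem variation_le_iff_varBound {q : ℝ → ℝ} {V : ℝ} (hV : 0 ≤ V) :
    variation q ≤ ENNReal.ofReal V ↔ VarBound q V := by
  simp only [variation, iSup_le_iff, VarBound, ENNReal.ofReal_le_ofReal_iff hV]

end UncenteredMaximal

/-! ### Conclusion. -/

theorem mainTheorem2 :
    ∃ C : ℝ, 0 < C ∧
      ∀ f : ℝ → ℝ, Function.Even f → AntitoneOn f (Set.Ioi 0) →
        ∀ f' : ℝ → ℝ, UncenteredMaximal.HasWeakDeriv f f' →
          (∀ x : ℝ, BddAbove (UncenteredMaximal.averages f x)) ∧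
          ∃ g : ℝ → ℝ,
            UncenteredMaximal.HasWeakDeriv (UncenteredMaximal.maximalFunction f) g ∧
            UncenteredMaximal.variation g ≤
              ENNReal.ofReal C * UncenteredMaximal.variation f' := by
  refine ⟨20, by norm_num, fun f he ha q hf => ?_⟩
  -- Averages ignore null sets, so `f` may be replaced by its continuous representative without
  -- changing the maximal function at any point.
  obtain ⟨F, hF, hw, hae⟩ := hf.exists_bell he ha
  have hav : ∀ x, UncenteredMaximal.averages f x = UncenteredMaximal.averages F x :=
    UncenteredMaximal.averages_congr hae
  have hM : UncenteredMaximal.maximalFunction f = UncenteredMaximal.maximalFunction F :=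
    funext fun x => congrArg sSup (hav x)
  rw [hM]
  refine ⟨fun x => hav x ▸ hF.bddAbove_averages x, _, hF.hasWeakDeriv_maximalFunction, ?_⟩
  rcases eq_or_ne (UncenteredMaximal.variation q) ⊤ with htop | hfin
  · rw [htop, ENNReal.mul_top (by simp)]
    exact le_top
  · rw [← ENNReal.ofReal_toReal hfin, ← ENNReal.ofReal_mul (by norm_num),
      UncenteredMaximal.variation_le_iff_varBound (by positivity)]
    refine hF.varBound_deriv_maximalFunction hw ?_
    rw [← UncenteredMaximal.variation_le_iff_varBound ENNReal.toReal_nonneg,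
      ENNReal.ofReal_toReal hfin]
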